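/- Let $0<\alpha<1$, $\lambda\ge 0$, $\kappa>0$, $L>0$, $T>0$ and let $k\ge 0$ be an integer. For a function $w$ that is absolutely continuous on $[0,T]$ put $${}^{C}_{0}D_t^{\alpha,\lambda}w(t)=\frac{e^{-\lambda t}}{\Gamma(1-\alpha)}\int_0^t (t-s)^{-\alpha}\,\frac{d}{ds}\bigl(e^{\lambda s}w(s)\bigr)\,ds ,$$ which is defined for almost every $t\in(0,T)$. **Exact solution.** Let $u:\mathbb R\times[0,T]\to\mathbb R$ be a solution of $${}^{C}_{0}D_t^{\alpha,\lambda}u(x,t)=\kappa\,u_{xx}(x,t),\qquad u(x,0)=u_0(x)\ (0\le x\le L),\qquad u(x+L,t)=u(x,t)\ (0<t\le T),$$ where the equation holds, for every $x$, at almost every $t\in(0,T]$, with the following regularity: for each $t\in[0,T]$ the function $u(\cdot,t)$ is of class $C^{k+3}$, the derivatives $\partial_x^i u$, $0\le i\le k+3$, are continuous on $\mathbb R\times[0,T]$, for each $x$ the function $u(x,\cdot)$ is absolutely continuous on $[0,T]$, and $\partial_t u$ is integrable on $(0,L)\times(0,T)$. **Semi-discrete LDG scheme.** Let $0=x_{1/2}<x_{3/2}<\dots<x_{N+1/2}=L$,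 $N\ge1$, $I_j=(x_{j-1/2},x_{j+1/2})$, $h=\max_j|I_j|$, and let $V_h$ be the space of functions whose restriction to each $I_j$ is a polynomial of degree at most $k$. For $v\in V_h$ let $v^-_{j+1/2}$ and $v^+_{j+1/2}$ be its limits at $x_{j+1/2}$ from $I_j$ and from $I_{j+1}$, the cells being numbered periodically ($I_0=I_N$, $I_{N+1}=I_1$). Let $u_h,p_h:[0,T]\to V_h$, with $u_h$ absolutely continuous in time, be such that for almost every $t\in(0,T]$, all $v,w\in V_h$ and all $1\le j\le N$ $$\int_{I_j}\bigl({}^{C}_{0}D_t^{\alpha,\lambda}u_h\bigr)\,v\,dx+\kappa\Bigl(\int_{I_j}p_h\,v_x\,dx-(p_h^+v^-)_{j+1/2}+(p_h^+v^+)_{j-1/2}\Bigr)=0,$$ $$\int_{I_j}p_h\,w\,dx+\int_{I_j}u_h\,w_x\,dx-(u_h^-w^-)_{j+1/2}+(u_h^-w^+)_{j-1/2}=0$$ (alternating numerical fluxes $\widehat u_h=u_h^-$, $\widehat p_h=p_h^+$). **Claim.** There is a constant $C>0$, which may depend on $\alpha,\lambda,\kappa,L,T,k$ and $u$, but not on the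 mesh, $u_h$ or $p_h$, such that for every mesh, every such $(u_h,p_h)$ and every $t\in[0,T]$, with $\|\cdot\|$ the norm of $L^2(0,L)$, $$\|u(\cdot,t)-u_h(\cdot,t)\|\le C\bigl(h^{k+1}+\|u_0-u_h(\cdot,0)\|\bigr).$$ Moreover, if $u_h(\cdot,0)=\mathcal P^-u_0$, where $\mathcal P^-u_0\in V_h$ is defined by $\int_{I_j}(\mathcal P^-u_0-u_0)\,v\,dx=0$ for all polynomials $v$ of degree at most $k-1$ (no condition if $k=0$) and $(\mathcal P^-u_0)^-_{j+1/2}=u_0(x_{j+1/2})$ for all $j$, then $$\|u(\cdot,t)-u_h(\cdot,t)\|\le C\,h^{k+1}\qquad\text{for all }t\in[0,T].$$ -/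

import Mathlib

open Polynomial

noncomputable section

namespace TemperedLDG

/-- Caputo tempered fractional derivative of order `α ∈ (0,1)` with parameter `lam`,
`e^{-lam t} / Γ(1-α) * ∫_0^t (t-s)^{-α} (d/ds) (e^{lam s} w(s)) ds`. -/
def caputoTempered (α lam : ℝ) (w : ℝ → ℝ) (t : ℝ) : ℝ :=
  Real.exp (-lam * t) / Real.Gamma (1 - α) *
    ∫ s in (0 : ℝ)..t, (t - s) ^ (-α) * deriv (fun r => Real.exp (lam * r) * w r) s

/-- A sufficiently regular solution `u(x,t)` on `ℝ × [0,T]` of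
`ᶜD_t^{α,lam} u = κ u_xx`, `u(x,0) = u₀(x)`, `u(x+L,t) = u(x,t)`.

In space `u` is `k+3` times differentiable, with derivatives continuous up to `t = 0`. In time only
absolute continuity on `[0,T]` with `∂_t u` integrable over `(0,L) × (0,T)` is asked, as solutions
of a time fractional equation have in general an unbounded `∂_t u` at `t = 0`. For an absolutely
continuous function the Caputo derivative is defined at almost every time. -/
structure IsRegularSolution (α lam κ L T : ℝ) (k : ℕ) (u₀ : ℝ → ℝ) (u : ℝ → ℝ → ℝ) : Prop where
  contDiff_space : ∀ t ∈ Set.Icc 0 T, ContDiff ℝ ((k + 3 : ℕ) : WithTop ℕ∞) (fun x => u x t)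
  continuousOn_deriv : ∀ i ≤ k + 3,
    ContinuousOn (fun z : ℝ × ℝ => iteratedDeriv i (fun x => u x z.2) z.1)
      (Set.univ ×ˢ Set.Icc 0 T)
  absCont_time : ∀ x, AbsolutelyContinuousOnInterval (fun t => u x t) 0 T
  integrable_time_deriv :
    MeasureTheory.IntegrableOn (fun z : ℝ × ℝ => deriv (fun t => u z.1 t) z.2)
      (Set.Ioo 0 L ×ˢ Set.Ioo 0 T)
  equation : ∀ x, ∀ᵐ t : ℝ, t ∈ Set.Ioc 0 T →
    caputoTempered α lam (fun s => u x s) t = κ * iteratedDeriv 2 (fun y => u y t) x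
  initial : ∀ x ∈ Set.Icc 0 L, u x 0 = u₀ x
  periodic : ∀ t ∈ Set.Ioc 0 T, ∀ x, u (x + L) t = u x t

/-- A partition `0 = x_{1/2} < x_{3/2} < ⋯ < x_{N+1/2} = L` into `N ≥ 1` cells. -/
structure Mesh (L : ℝ) where
  N : ℕ
  N_pos : 0 < N
  node : Fin (N + 1) → ℝ
  strictMono : StrictMono node
  node_zero : node 0 = 0
  node_last : node (Fin.last N) = L

namespace Mesh

variable {L : ℝ} (M : Mesh L)

/-- Left end point of the cell `j`. -/
def left (j : Fin M.N) : ℝ := M.node j.castSucc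

/-- Right end point of the cell `j`. -/
def right (j : Fin M.N) : ℝ := M.node j.succ

/-- The mesh size `h`, the maximum of the lengths of the (finitely many) cells. -/
def h : ℝ := ⨆ j : Fin M.N, (M.right j - M.left j)

/-- The finite element space `V_h`: a polynomial of degree at most `k` on every cell. -/
abbrev Space (k : ℕ) : Type := Fin M.N → Polynomial.degreeLT ℝ (k + 1)

variable {M} {k : ℕ}

/-- Value at `x` of the polynomial that represents `v` on the cell `j`. -/
def val (v : M.Space k) (j : Fin M.N) (x : ℝ) : ℝ := (v j : ℝ[X]).eval x

/-- The numerical flux `v⁻` at the right end of the cell `j`: limit from the cell `j`. -/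
def minusRight (v : M.Space k) (j : Fin M.N) : ℝ := val v j (M.right j)

/-- The flux `v⁻` at the left end of the cell `j`: limit from the preceding cell, where by
periodicity the last cell precedes the first one. -/
def minusLeft (v : M.Space k) (j : Fin M.N) : ℝ := minusRight v ((finRotate M.N).symm j)

/-- The flux `v⁺` at the left end of the cell `j`: limit from the cell `j`. -/
def plusLeft (v : M.Space k) (j : Fin M.N) : ℝ := val v j (M.left j)

/-- The flux `v⁺` at the right end of the cell `j`: limit from the following cell, where by
periodicity the first cell follows the last one. -/
def plusRight (v : M.Space k) (j : Fin M.N) : ℝ := plusLeft v (finRotate M.N j)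

/-- The norm of `w - v` in `L²(0,L)`, for `v ∈ V_h`. -/
def errNorm (w : ℝ → ℝ) (v : M.Space k) : ℝ :=
  Real.sqrt (∑ j : Fin M.N, ∫ x in (M.left j)..(M.right j), (w x - val v j x) ^ 2)

/-- `q = P⁻ w`: on every cell `q - w` is orthogonal to the polynomials of degree at most `k - 1`
(no condition for `k = 0`), and `q⁻ = w` at the right end. -/
def IsProjMinus (w : ℝ → ℝ) (q : M.Space k) : Prop :=
  ∀ j : Fin M.N,
    (∀ v ∈ Polynomial.degreeLT ℝ k,
      ∫ x in (M.left j)..(M.right j), (val q j x - w x) * v.eval x = 0) ∧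
    minusRight q j = w (M.right j)

/-- First equation of the scheme on the cell `j` at time `t`, with `p̂ = p⁺`. -/
def FirstEq (α lam κ : ℝ) (uh ph : ℝ → M.Space k) (t : ℝ) (j : Fin M.N) (v : M.Space k) : Prop :=
  (∫ x in (M.left j)..(M.right j),
      caputoTempered α lam (fun s => val (uh s) j x) t * val v j x) +
    κ * ((∫ x in (M.left j)..(M.right j), val (ph t) j x * (derivative (v j : ℝ[X])).eval x)
      - plusRight (ph t) j * val v j (M.right j)
      + plusLeft (ph t) j * val v j (M.left j)) = 0

/-- Second equation of the scheme on the cell `j` at time `t`, with `û = u⁻`. -/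
def SecondEq (uh ph : ℝ → M.Space k) (t : ℝ) (j : Fin M.N) (w : M.Space k) : Prop :=
  (∫ x in (M.left j)..(M.right j), val (ph t) j x * val w j x) +
    (∫ x in (M.left j)..(M.right j), val (uh t) j x * (derivative (w j : ℝ[X])).eval x)
      - minusRight (uh t) j * val w j (M.right j)
      + minusLeft (uh t) j * val w j (M.left j) = 0

/-- `(u_h, p_h)` solves the semi-discrete scheme on `(0,T]`. The function `u_h` is absolutely
continuous in time, and the equations hold at almost every time. -/
structure IsSemiDiscreteSolution (α lam κ T : ℝ) (uh ph : ℝ → M.Space k) : Prop where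
  absCont_time : ∀ j x, AbsolutelyContinuousOnInterval (fun t => val (uh t) j x) 0 T
  equations : ∀ᵐ t : ℝ, t ∈ Set.Ioc 0 T → ∀ v w : M.Space k, ∀ j : Fin M.N,
    FirstEq α lam κ uh ph t j v ∧ SecondEq uh ph t j w

end Mesh

end TemperedLDG

end

/-! Multiplication by `e^{lam t}` turns the tempered derivative into an ordinary Caputo derivative,
that is, into the Abel integral of the derivative (`abelInt_deriv_exp_mul`). The error is split as
`u - u_h = (u - q) + (q - u_h)`, where `q` is the one-sided projection of `u` matching its value at
the right end of every cell. The first part is `O(h^{k+1})` by approximation theory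
(`exists_isCellProj_error`). The second lies in `V_h` and is controlled by an energy argument.

The coefficients of `q` are fixed linear functionals of `u(·,t)`, so the projection commutes with
the fractional time derivative, and the derivative of `q` is `κ` times the projection of `u_xx`
(`ae_abelInt_deriv_integral` for the moments, the equation itself for the nodal values). The
consistency error in time is therefore a projection error of `u_xx`; no bound on `∂_t u` enters, and
this is where `k + 3` space derivatives are spent.

In space, the scheme is tested with `q - u_h` and with `r - p_h`, where `r` is the projection of
`u_x` matching at left ends. The two projections are matched to the alternating fluxes:
orthogonality removes the volume terms, and the remaining node terms cancel around the periodic mesh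
(`energy_identity`). Young's inequality then gives `energy_estimate`.

In time, Alikhanov's inequality `abelInt_deriv_quadForm_le` bounds the fractional derivative of `Y =
e^{2 lam t} ‖q - u_h‖²` by twice the pairing of the error with its fractional derivative. Abel
inversion converts this into a bound of `Y(t) - Y(0)` (`sub_le_of_abelInt_deriv_le`). The term
containing `Y` has a free factor `δ`; it is evaluated at the maximum of `Y` and absorbed, so no
fractional Gronwall inequality is needed (`exists_growth`). -/

noncomputable section

namespace TemperedLDG

open MeasureTheory Set Filter Topology

/-! ### Abel integrals: integrability and inversion -/

/-- The Abel integral `∫₀ᵗ (t - s)^{-β} φ(s) ds`. -/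
def abelInt (β : ℝ) (φ : ℝ → ℝ) (t : ℝ) : ℝ := ∫ s in (0 : ℝ)..t, (t - s) ^ (-β) * φ s

/-- This is the Beta integral with parameters `1 - β` and `β`. The exponents add up to `-1`, so the
length of the interval drops out. -/
lemma integral_abelKernel {β r t : ℝ} (h0 : 0 < β) (h1 : β < 1) (hrt : r < t) :
    ∫ s in r..t, (t - s) ^ (-(1 - β)) * (s - r) ^ (-β) = Real.Gamma β * Real.Gamma (1 - β) := by
  have h2 : ∫ s in r..t, (t - s) ^ (-(1 - β)) * (s - r) ^ (-β)
      = ∫ x in (0 : ℝ)..(t - r), x ^ (-β) * ((t - r) - x) ^ (-(1 - β)) := by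
    have := intervalIntegral.integral_comp_sub_right (a := r) (b := t)
      (fun x => x ^ (-β) * ((t - r) - x) ^ (-(1 - β))) r
    rw [sub_self] at this
    rw [← this]
    congr 1
    ext s
    rw [mul_comm]
    congr 2
    ring
  have ha : 0 < t - r := sub_pos.2 hrt
  rw [h2]
  have h3 := Complex.betaIntegral_scaled ((1 - β : ℝ) : ℂ) (β : ℂ) ha
  have h4 := Complex.Gamma_mul_Gamma_eq_betaIntegral (s := ((1 - β : ℝ) : ℂ)) (t := (β : ℂ))
    (by simpa using h1) (by simpa using h0)
  have h5 : ((1 - β : ℝ) : ℂ) + (β : ℂ) = 1 := by push_cast; ring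
  rw [h5, sub_self, Complex.cpow_zero, one_mul] at h3
  rw [h5, Complex.Gamma_one, one_mul, ← h3, Complex.Gamma_ofReal, Complex.Gamma_ofReal] at h4
  have h6 : ∫ x in (0 : ℝ)..(t - r), (x : ℂ) ^ (((1 - β : ℝ) : ℂ) - 1)
        * (((t - r : ℝ) : ℂ) - x) ^ ((β : ℂ) - 1)
      = ((∫ x in (0 : ℝ)..(t - r), x ^ (-β) * ((t - r) - x) ^ (-(1 - β)) : ℝ) : ℂ) := by
    rw [← intervalIntegral.integral_ofReal]
    apply intervalIntegral.integral_congr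
    intro x hx
    rw [uIcc_of_le ha.le] at hx
    simp only
    rw [Complex.ofReal_mul, Complex.ofReal_cpow hx.1, Complex.ofReal_cpow (sub_nonneg.2 hx.2)]
    congr 2
    · push_cast; ring
    · push_cast; ring
    · push_cast; ring
  rw [h6] at h4
  rw [← Complex.ofReal_mul] at h4
  have := Complex.ofReal_injective h4
  rw [← this, mul_comm]

/-- A non-integrable function would have interval integral zero, whereas the value just computed is
positive. -/
lemma intervalIntegrable_abelKernel {β r t : ℝ} (h0 : 0 < β) (h1 : β < 1) (hrt : r < t) :
    IntervalIntegrable (fun s => (t - s) ^ (-(1 - β)) * (s - r) ^ (-β)) volume r t := by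
  by_contra h
  have h2 := integral_abelKernel h0 h1 hrt
  rw [intervalIntegral.integral_undef h] at h2
  have := mul_pos (Real.Gamma_pos_of_pos h0) (Real.Gamma_pos_of_pos (sub_pos.2 h1))
  linarith

/-- The triangular kernel of the composition of two Abel integrals. -/
def abelTri (β t : ℝ) (φ : ℝ → ℝ) (z : ℝ × ℝ) : ℝ :=
  (if z.2 < z.1 then (t - z.1) ^ (-(1 - β)) * (z.1 - z.2) ^ (-β) else 0) * φ z.2

lemma abelTri_slice_eq {β t : ℝ} (r : ℝ) (φ : ℝ → ℝ) :
    (fun s => abelTri β t φ (s, r)) =ᵐ[volume.restrict (Ioc 0 t)]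
      (Ioc r t).indicator (fun s => (t - s) ^ (-(1 - β)) * (s - r) ^ (-β) * φ r) := by
  filter_upwards [ae_restrict_mem measurableSet_Ioc] with s hs
  simp only [abelTri, indicator, mem_Ioc]
  by_cases h : r < s
  · rw [if_pos h, if_pos ⟨h, hs.2⟩]
  · rw [if_neg h, if_neg (fun h' => h h'.1), zero_mul]

/-- Tonelli, integrating in the outer time first: the kernel then contributes a constant independent
of `r`, and only the integral of `|φ|` remains. -/
lemma integrable_abelTri {β t : ℝ} (h0 : 0 < β) (h1 : β < 1) {φ : ℝ → ℝ}
    (hφ : IntegrableOn φ (Ioc 0 t)) :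
    Integrable (abelTri β t φ)
      ((volume.restrict (Ioc 0 t)).prod (volume.restrict (Ioc 0 t))) := by
  have hmeas : AEStronglyMeasurable (abelTri β t φ)
      ((volume.restrict (Ioc 0 t)).prod (volume.restrict (Ioc 0 t))) := by
    unfold abelTri
    refine AEStronglyMeasurable.mul ?_ hφ.aestronglyMeasurable.comp_snd
    apply Measurable.aestronglyMeasurable
    refine Measurable.ite (measurableSet_lt measurable_snd measurable_fst) ?_ measurable_const
    fun_prop
  rw [integrable_prod_iff' hmeas]
  have hne : ∀ᵐ r ∂(volume.restrict (Ioc 0 t)), r ≠ t :=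
    ae_restrict_of_ae (by simp [ae_iff, measure_singleton])
  have hsub : ∀ r ∈ Ioc 0 t, Ioc r t ⊆ Ioc 0 t := fun r hr => Ioc_subset_Ioc_left hr.1.le
  constructor
  · filter_upwards [ae_restrict_mem measurableSet_Ioc, hne] with r hr hrt
    have hrt' : r < t := lt_of_le_of_ne hr.2 hrt
    refine Integrable.congr ?_ (abelTri_slice_eq r φ).symm
    rw [integrable_indicator_iff measurableSet_Ioc]
    have := (intervalIntegrable_abelKernel h0 h1 hrt').1
    unfold IntegrableOn at this ⊢
    rw [Measure.restrict_restrict measurableSet_Ioc, inter_eq_left.2 (hsub r hr)]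
    exact this.mul_const _
  · refine (hφ.norm.const_mul (Real.Gamma β * Real.Gamma (1 - β))).congr ?_
    filter_upwards [ae_restrict_mem measurableSet_Ioc, hne] with r hr hrt
    have hrt' : r < t := lt_of_le_of_ne hr.2 hrt
    have h2 : (fun s => ‖abelTri β t φ (s, r)‖) =ᵐ[volume.restrict (Ioc 0 t)]
      (Ioc r t).indicator (fun s => (t - s) ^ (-(1 - β)) * (s - r) ^ (-β) * ‖φ r‖) := by
      filter_upwards [abelTri_slice_eq (β := β) r φ] with s hs
      rw [hs, norm_indicator_eq_indicator_norm]
      refine congrFun (indicator_congr (fun s hs => ?_)) s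
      rw [norm_mul, Real.norm_of_nonneg]
      exact mul_nonneg (Real.rpow_nonneg (sub_nonneg.2 hs.2) _)
        (Real.rpow_nonneg (sub_nonneg.2 hs.1.le) _)
    rw [integral_congr_ae h2, integral_indicator measurableSet_Ioc,
      Measure.restrict_restrict measurableSet_Ioc, inter_eq_left.2 (hsub r hr),
      integral_mul_const, ← intervalIntegral.integral_of_le hrt'.le,
      integral_abelKernel h0 h1 hrt']

lemma abelTri_slice_eq' {β t : ℝ} (s : ℝ) (φ : ℝ → ℝ) :
    (fun r => abelTri β t φ (s, r)) =ᵐ[volume.restrict (Ioc 0 t)]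
      (Ioc 0 s).indicator (fun r => (t - s) ^ (-(1 - β)) * ((s - r) ^ (-β) * φ r)) := by
  have hne : ∀ᵐ r ∂(volume.restrict (Ioc 0 t)), r ≠ s :=
    ae_restrict_of_ae (by simp [ae_iff, measure_singleton])
  filter_upwards [ae_restrict_mem measurableSet_Ioc, hne] with r hr hrs
  simp only [abelTri, indicator, mem_Ioc]
  by_cases h : r < s
  · rw [if_pos h, if_pos ⟨hr.1, h.le⟩, mul_assoc]
  · rw [if_neg h, if_neg (fun h' => h (lt_of_le_of_ne h'.2 hrs)), zero_mul]

lemma integral_abelTri_slice {β t : ℝ} {s : ℝ} (hs : s ∈ Ioc 0 t) (φ : ℝ → ℝ) :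
    ∫ r in Ioc 0 t, abelTri β t φ (s, r) = (t - s) ^ (-(1 - β)) * abelInt β φ s := by
  rw [integral_congr_ae (abelTri_slice_eq' s φ), integral_indicator measurableSet_Ioc,
    Measure.restrict_restrict measurableSet_Ioc, inter_eq_left.2 (Ioc_subset_Ioc_right hs.2),
    integral_const_mul, abelInt, intervalIntegral.integral_of_le hs.1.le]

/-- `(t - s)^{-(1-β)} J_β φ(s)` is integrable in `s`. -/
lemma intervalIntegrable_abel_abelInt {β t : ℝ} (h0 : 0 < β) (h1 : β < 1) (ht : 0 ≤ t)
    {φ : ℝ → ℝ} (hφ : IntervalIntegrable φ volume 0 t) :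
    IntervalIntegrable (fun s => (t - s) ^ (-(1 - β)) * abelInt β φ s) volume 0 t := by
  rw [intervalIntegrable_iff_integrableOn_Ioc_of_le ht] at hφ ⊢
  refine (integrable_abelTri h0 h1 hφ).integral_prod_left.congr ?_
  filter_upwards [ae_restrict_mem measurableSet_Ioc] with s hs
  exact integral_abelTri_slice hs φ

/-- Abel inversion. -/
lemma abelInt_abelInt {β t : ℝ} (h0 : 0 < β) (h1 : β < 1) (ht : 0 ≤ t)
    {φ : ℝ → ℝ} (hφ : IntervalIntegrable φ volume 0 t) :
    abelInt (1 - β) (abelInt β φ) t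
      = Real.Gamma β * Real.Gamma (1 - β) * ∫ s in (0 : ℝ)..t, φ s := by
  rw [intervalIntegrable_iff_integrableOn_Ioc_of_le ht] at hφ
  have hI := integrable_abelTri h0 h1 hφ
  have h2 := integral_integral_swap (f := fun s r => abelTri β t φ (s, r)) hI
  have h3 : ∫ s in Ioc 0 t, ∫ r in Ioc 0 t, abelTri β t φ (s, r)
      = abelInt (1 - β) (abelInt β φ) t := by
    rw [abelInt, intervalIntegral.integral_of_le ht]
    exact setIntegral_congr_fun measurableSet_Ioc fun s hs => integral_abelTri_slice hs φ
  have hne : ∀ᵐ r ∂(volume.restrict (Ioc 0 t)), r ≠ t :=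
    ae_restrict_of_ae (by simp [ae_iff, measure_singleton])
  rw [← h3, h2, intervalIntegral.integral_of_le ht, ← integral_const_mul]
  apply integral_congr_ae
  filter_upwards [ae_restrict_mem measurableSet_Ioc, hne] with r hr hrt
  have hrt' : r < t := lt_of_le_of_ne hr.2 hrt
  rw [integral_congr_ae (abelTri_slice_eq r φ), integral_indicator measurableSet_Ioc,
    Measure.restrict_restrict measurableSet_Ioc, inter_eq_left.2 (Ioc_subset_Ioc_left hr.1.le),
    integral_mul_const, ← intervalIntegral.integral_of_le hrt'.le,
    integral_abelKernel h0 h1 hrt']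

/-- The Abel integral of an integrable function converges at almost every time. -/
lemma ae_intervalIntegrable_abel {β T : ℝ} (h0 : 0 < β) (h1 : β < 1) (hT : 0 ≤ T)
    {φ : ℝ → ℝ} (hφ : IntervalIntegrable φ volume 0 T) :
    ∀ᵐ t : ℝ, t ∈ Ioc 0 T → IntervalIntegrable (fun s => (t - s) ^ (-β) * φ s) volume 0 t := by
  rw [intervalIntegrable_iff_integrableOn_Ioc_of_le hT] at hφ
  have hI := (integrable_abelTri h0 h1 hφ).prod_right_ae
  have hI' := (ae_restrict_iff' measurableSet_Ioc).1 hI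
  have hne : ∀ᵐ t : ℝ, t ≠ T := by simp [ae_iff, measure_singleton]
  filter_upwards [hI', hne] with t ht htT htm
  have h2 := (ht htm).congr (abelTri_slice_eq' t φ)
  rw [integrable_indicator_iff measurableSet_Ioc] at h2
  unfold IntegrableOn at h2
  rw [Measure.restrict_restrict measurableSet_Ioc,
    inter_eq_left.2 (Ioc_subset_Ioc_right htm.2)] at h2
  rw [intervalIntegrable_iff_integrableOn_Ioc_of_le htm.1.le]
  -- The slice at time `t` of the triangular kernel with end time `T` carries the factor `(T -
  -- t)^{-(1-β)}`. For `t < T` it is positive and can be divided out.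
  have hpos : 0 < (T - t) ^ (-(1 - β)) :=
    Real.rpow_pos_of_pos (sub_pos.2 (lt_of_le_of_ne htm.2 htT)) _
  refine (h2.const_mul ((T - t) ^ (-(1 - β)))⁻¹).congr ?_
  filter_upwards with s
  rw [inv_mul_cancel_left₀ hpos.ne']

/-- The Abel integral of an integrable function is integrable. -/
lemma intervalIntegrable_abelInt {β T : ℝ} (h0 : 0 < β) (h1 : β < 1) (hT : 0 ≤ T)
    {φ : ℝ → ℝ} (hφ : IntervalIntegrable φ volume 0 T) :
    IntervalIntegrable (abelInt β φ) volume 0 T := by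
  have h2 := intervalIntegrable_abel_abelInt h0 h1 hT hφ
  -- Multiplying by this bounded factor removes the weight with which integrability is already
  -- known.
  have hc : ContinuousOn (fun s : ℝ => (T - s) ^ (1 - β)) (uIcc 0 T) :=
    Continuous.continuousOn
      ((continuous_const.sub continuous_id).rpow_const fun x => Or.inr (sub_nonneg.2 h1.le))
  refine (h2.continuousOn_mul hc).congr_ae ?_
  have hne : ∀ᵐ t ∂(volume.restrict (uIoc 0 T)), t ≠ T :=
    ae_restrict_of_ae (by simp [ae_iff, measure_singleton])
  filter_upwards [ae_restrict_mem measurableSet_uIoc, hne] with t ht htT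
  rw [uIoc_of_le hT] at ht
  have hpos : 0 < T - t := sub_pos.2 (lt_of_le_of_ne ht.2 htT)
  rw [← mul_assoc, ← Real.rpow_add hpos, add_neg_cancel, Real.rpow_zero, one_mul]

/-! ### Absolutely continuous functions and Alikhanov's inequality -/

lemma absolutelyContinuousOnInterval_of_contDiffOn {f : ℝ → ℝ} {a b : ℝ}
    (hf : ContDiffOn ℝ 1 f (uIcc a b)) : AbsolutelyContinuousOnInterval f a b := by
  obtain ⟨K, hK⟩ := (hf.locallyLipschitzOn (convex_uIcc a b)).exists_lipschitzOnWith_of_compact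
    isCompact_uIcc
  exact hK.absolutelyContinuousOnInterval

lemma absolutelyContinuousOnInterval_const (x a b : ℝ) :
    AbsolutelyContinuousOnInterval (fun _ => x) a b :=
  absolutelyContinuousOnInterval_of_contDiffOn contDiffOn_const

lemma absolutelyContinuousOnInterval_sum {ι : Type*} {a b : ℝ} (S : Finset ι)
    {c : ι → ℝ → ℝ} (hc : ∀ i ∈ S, AbsolutelyContinuousOnInterval (c i) a b) :
    AbsolutelyContinuousOnInterval (fun s => ∑ i ∈ S, c i s) a b := by
  classical
  induction S using Finset.induction_on with
  | empty => simpa using absolutelyContinuousOnInterval_const 0 a b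
  | insert i S hi ih =>
    simp_rw [Finset.sum_insert hi]
    exact (hc i (Finset.mem_insert_self _ _)).add
      (ih fun j hj => hc j (Finset.mem_insert_of_mem hj))

/-- Linearity of the Abel integral of the derivative, simultaneously for all linear combinations. -/
lemma abelInt_deriv_sum {ι : Type*} [Fintype ι] {β T : ℝ} (h0 : 0 < β) (h1 : β < 1)
    (hT : 0 ≤ T) {c : ι → ℝ → ℝ} (hc : ∀ i, AbsolutelyContinuousOnInterval (c i) 0 T) :
    ∀ᵐ t : ℝ, t ∈ Ioc 0 T → ∀ x : ι → ℝ,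
      IntervalIntegrable (fun s => (t - s) ^ (-β) * deriv (fun r => ∑ i, x i * c i r) s)
        volume 0 t ∧
      abelInt β (deriv fun r => ∑ i, x i * c i r) t = ∑ i, x i * abelInt β (deriv (c i)) t := by
  -- The null sets depend only on the functions `c i`. The weights `x` may thus be chosen after `t`,
  -- as Alikhanov's inequality requires.
  have hI : ∀ᵐ t : ℝ, ∀ i, t ∈ Ioc 0 T →
      IntervalIntegrable (fun s => (t - s) ^ (-β) * deriv (c i) s) volume 0 t :=
    ae_all_iff.2 fun i => ae_intervalIntegrable_abel h0 h1 hT (hc i).intervalIntegrable_deriv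
  have hd : ∀ᵐ s : ℝ, ∀ i, s ∈ uIcc 0 T → DifferentiableAt ℝ (c i) s :=
    ae_all_iff.2 fun i => (hc i).ae_differentiableAt
  filter_upwards [hI] with t ht htm x
  have heq : ∀ᵐ s : ℝ, s ∈ uIoc 0 t → ∑ i, x i * ((t - s) ^ (-β) * deriv (c i) s) =
      (t - s) ^ (-β) * deriv (fun r => ∑ i, x i * c i r) s := by
    filter_upwards [hd] with s hs hst
    rw [uIoc_of_le htm.1.le] at hst
    have hsm : s ∈ uIcc 0 T := by
      rw [uIcc_of_le hT]
      exact ⟨hst.1.le, hst.2.trans htm.2⟩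
    have h2 : HasDerivAt (fun r => ∑ i, x i * c i r) (∑ i, x i * deriv (c i) s) s :=
      HasDerivAt.fun_sum fun i _ => (hs i hsm).hasDerivAt.const_mul (x i)
    rw [h2.deriv, Finset.mul_sum]
    exact Finset.sum_congr rfl fun i _ => by ring
  have hsum : IntervalIntegrable (fun s => ∑ i, x i * ((t - s) ^ (-β) * deriv (c i) s))
      volume 0 t := by
    have := IntervalIntegrable.sum Finset.univ fun i _ => (ht i htm).const_mul (x i)
    refine this.congr_ae (Eventually.of_forall fun s => ?_)
    simp
  refine ⟨hsum.congr_ae ((ae_restrict_iff' measurableSet_uIoc).2 heq), ?_⟩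
  unfold abelInt
  rw [← intervalIntegral.integral_congr_ae heq,
    intervalIntegral.integral_finsetSum fun i _ => (ht i htm).const_mul (x i)]
  exact Finset.sum_congr rfl fun i _ => intervalIntegral.integral_const_mul _ _

/-- Integrating by parts up to `r < t`, the kernel is increasing and `w ≥ 0`, so every term except
the boundary term at `r` has the favourable sign. That term is `(t - r)^{-β} w(r)`; it tends to zero
because `w` and its derivative vanish at `t`. -/
lemma abelInt_deriv_nonpos {β t : ℝ} (h0 : 0 < β) (h1 : β < 1) (ht : 0 < t) {w : ℝ → ℝ}
    (hw : AbsolutelyContinuousOnInterval w 0 t) (hw0 : ∀ s, 0 ≤ w s) (hwt : w t = 0)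
    (hd : HasDerivAt w 0 t)
    (hint : IntervalIntegrable (fun s => (t - s) ^ (-β) * deriv w s) volume 0 t) :
    abelInt β (deriv w) t ≤ 0 := by
  have hcont : ContinuousOn (fun r => ∫ s in (0 : ℝ)..r, (t - s) ^ (-β) * deriv w s)
      (uIcc 0 t) := intervalIntegral.continuousOn_primitive_interval' hint left_mem_uIcc
  have hle : ∀ r ∈ Ioo 0 t, ∫ s in (0 : ℝ)..r, (t - s) ^ (-β) * deriv w s
      ≤ (t - r) ^ (-β) * w r := by
    intro r hr
    have hsub : uIcc 0 r ⊆ uIcc 0 t := by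
      rw [uIcc_of_le hr.1.le, uIcc_of_le ht.le]
      exact Icc_subset_Icc_right hr.2.le
    have hderiv : ∀ s ∈ uIcc 0 r, HasDerivAt (fun s : ℝ => (t - s) ^ (-β))
        (β * (t - s) ^ (-β - 1)) s := by
      intro s hs
      rw [uIcc_of_le hr.1.le] at hs
      have h2 := ((hasDerivAt_id s).const_sub t).rpow_const (p := -β)
        (Or.inl (sub_pos.2 (hs.2.trans_lt hr.2)).ne')
      rw [neg_one_mul, neg_neg] at h2
      exact h2
    have hac : AbsolutelyContinuousOnInterval (fun s : ℝ => (t - s) ^ (-β)) 0 r := by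
      apply absolutelyContinuousOnInterval_of_contDiffOn
      intro s hs
      rw [uIcc_of_le hr.1.le] at hs
      exact ((contDiffAt_const.sub contDiffAt_id).rpow_const_of_ne
        (sub_pos.2 (hs.2.trans_lt hr.2)).ne').contDiffWithinAt
    rw [hac.integral_mul_deriv_eq_deriv_mul (hw.mono hsub)]
    have h2 : 0 ≤ ∫ s in (0 : ℝ)..r, deriv (fun s : ℝ => (t - s) ^ (-β)) s * w s := by
      apply intervalIntegral.integral_nonneg hr.1.le
      intro s hs
      rw [(hderiv s (by rwa [uIcc_of_le hr.1.le])).deriv]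
      have : 0 ≤ t - s := sub_nonneg.2 (hs.2.trans hr.2.le)
      have := hw0 s
      positivity
    have h3 : 0 ≤ (t - 0) ^ (-β) * w 0 :=
      mul_nonneg (Real.rpow_nonneg (by linarith) _) (hw0 0)
    linarith
  have hne : (𝓝[<] t).NeBot := inferInstance
  have hIoo : Ioo 0 t ∈ 𝓝[<] t := Ioo_mem_nhdsLT ht
  have hlim1 : Tendsto (fun r => ∫ s in (0 : ℝ)..r, (t - s) ^ (-β) * deriv w s) (𝓝[<] t)
      (𝓝 (abelInt β (deriv w) t)) := by
    refine (hcont t right_mem_uIcc).mono_left ?_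
    rw [uIcc_of_le ht.le]
    exact nhdsWithin_le_of_mem (mem_of_superset hIoo Ioo_subset_Icc_self)
  have hlim2 : Tendsto (fun r => (t - r) ^ (-β) * w r) (𝓝[<] t) (𝓝 0) := by
    have h2 : Tendsto (fun r => slope w t r) (𝓝[<] t) (𝓝 0) :=
      (hasDerivAt_iff_tendsto_slope.1 hd).mono_left
        (nhdsWithin_mono t fun r hr => ne_of_lt hr)
    have h3 : Tendsto (fun r : ℝ => (t - r) ^ (1 - β)) (𝓝[<] t) (𝓝 0) := by
      have hc : Continuous fun r : ℝ => (t - r) ^ (1 - β) :=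
        (continuous_const.sub continuous_id).rpow_const fun x => Or.inr (sub_nonneg.2 h1.le)
      have := hc.tendsto t
      rw [sub_self, Real.zero_rpow (sub_pos.2 h1).ne'] at this
      exact this.mono_left nhdsWithin_le_nhds
    have h4 := (h3.mul h2).neg
    rw [mul_zero, neg_zero] at h4
    refine h4.congr' ?_
    filter_upwards [hIoo] with r hr
    have hpos : 0 < t - r := sub_pos.2 hr.2
    rw [slope_def_field, hwt, sub_zero, sub_eq_add_neg 1 β, Real.rpow_add hpos, Real.rpow_one]
    have : r - t ≠ 0 := by linarith
    field_simp
    ring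
  exact le_of_tendsto_of_tendsto hlim1 hlim2
    (by filter_upwards [hIoo] with r hr using hle r hr)

/-- The quadratic form with coefficients `B`. -/
def quadForm {ι : Type*} [Fintype ι] (B : ι → ι → ℝ) (v : ι → ℝ) : ℝ :=
  ∑ a, ∑ b, B a b * v a * v b

lemma absolutelyContinuousOnInterval_quadForm {ι : Type*} [Fintype ι] {T : ℝ} (B : ι → ι → ℝ)
    {c : ι → ℝ → ℝ} (hc : ∀ i, AbsolutelyContinuousOnInterval (c i) 0 T) :
    AbsolutelyContinuousOnInterval (fun s => quadForm B fun i => c i s) 0 T := by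
  unfold quadForm
  refine absolutelyContinuousOnInterval_sum _ fun a _ =>
    absolutelyContinuousOnInterval_sum _ fun b _ => ?_
  exact ((hc a).const_mul (B a b)).fun_mul (hc b)

lemma quadForm_sub {ι : Type*} [Fintype ι] {B : ι → ι → ℝ} (hB : ∀ a b, B a b = B b a)
    (v w : ι → ℝ) : quadForm B (fun i => v i - w i) =
      quadForm B v + ∑ b, (-2 * ∑ a, B a b * w a) * v b + quadForm B w := by
  have h1 : ∑ a, ∑ b, B a b * v a * w b = ∑ a, ∑ b, B a b * w a * v b := by
    rw [Finset.sum_comm]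
    exact Finset.sum_congr rfl fun a _ => Finset.sum_congr rfl fun b _ => by rw [hB b a]; ring
  have h2 : ∑ b, (-2 * ∑ a, B a b * w a) * v b = -2 * ∑ a, ∑ b, B a b * w a * v b := by
    rw [Finset.sum_comm, Finset.mul_sum]
    exact Finset.sum_congr rfl fun b _ => by rw [mul_assoc, Finset.sum_mul]
  have h3 : quadForm B (fun i => v i - w i) = ∑ a, ∑ b, B a b * v a * v b
      - ∑ a, ∑ b, B a b * v a * w b - ∑ a, ∑ b, B a b * w a * v b
      + ∑ a, ∑ b, B a b * w a * w b := by
    unfold quadForm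
    simp_rw [← Finset.sum_sub_distrib, ← Finset.sum_add_distrib]
    exact Finset.sum_congr rfl fun a _ => Finset.sum_congr rfl fun b _ => by ring
  rw [h2, h3, h1]
  unfold quadForm
  ring

/-- Alikhanov's inequality for a positive semidefinite quadratic form. -/
lemma abelInt_deriv_quadForm_le {ι : Type*} [Fintype ι] {β T : ℝ} (h0 : 0 < β) (h1 : β < 1)
    (hT : 0 ≤ T) {B : ι → ι → ℝ} (hB : ∀ a b, B a b = B b a) (hpos : ∀ v, 0 ≤ quadForm B v)
    {c : ι → ℝ → ℝ} (hc : ∀ i, AbsolutelyContinuousOnInterval (c i) 0 T) :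
    ∀ᵐ t : ℝ, t ∈ Ioc 0 T → abelInt β (deriv fun s => quadForm B fun i => c i s) t
      ≤ 2 * ∑ b, (∑ a, B a b * c a t) * abelInt β (deriv (c b)) t := by
  set q : ℝ → ℝ := fun s => quadForm B fun i => c i s with hq
  have hqac : AbsolutelyContinuousOnInterval q 0 T := absolutelyContinuousOnInterval_quadForm B hc
  -- The quadratic form is adjoined as one more component, so that its expansion about `c(t)` is a
  -- linear combination to which linearity of the Abel integral applies.
  let f : Option ι → ℝ → ℝ := fun o => o.elim q c
  have hf : ∀ o, AbsolutelyContinuousOnInterval (f o) 0 T := by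
    rintro (_ | i)
    · exact hqac
    · exact hc i
  have hd : ∀ᵐ s : ℝ, ∀ i, s ∈ uIcc 0 T → DifferentiableAt ℝ (c i) s :=
    ae_all_iff.2 fun i => (hc i).ae_differentiableAt
  filter_upwards [abelInt_deriv_sum h0 h1 hT hf, hd] with t ht htd htm
  let x : Option ι → ℝ := fun o => o.elim 1 fun b => -2 * ∑ a, B a b * c a t
  obtain ⟨hint, hsum⟩ := ht htm x
  -- Positive semidefiniteness gives `w ≥ 0`, and differentiability of `c` at `t` gives `w(t) =
  -- w'(t) = 0`. Expanding the square, the sign of the Abel integral of `w'` is exactly the claim.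
  let w : ℝ → ℝ := fun s => quadForm B fun i => c i s - c i t
  have hw : ∀ s, w s = (∑ o, x o * f o s) + q t := by
    intro s
    simp only [w, quadForm_sub hB, Fintype.sum_option, x, f, Option.elim, q, one_mul]
  have hderiv : deriv w = deriv fun s => ∑ o, x o * f o s := by
    rw [funext hw]
    funext s
    exact deriv_add_const _
  have htmem : t ∈ uIcc 0 T := by
    rw [uIcc_of_le hT]
    exact ⟨htm.1.le, htm.2⟩
  have hwd : HasDerivAt w 0 t := by
    have h2 : HasDerivAt w (∑ a, ∑ b, ((B a b * deriv (c a) t) * (c b t - c b t)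
        + B a b * (c a t - c a t) * deriv (c b) t)) t := by
      refine HasDerivAt.fun_sum fun a _ => HasDerivAt.fun_sum fun b _ => ?_
      exact ((((htd a htmem).hasDerivAt.sub_const (c a t)).const_mul (B a b))).mul
        ((htd b htmem).hasDerivAt.sub_const (c b t))
    simpa using h2
  have hwac : AbsolutelyContinuousOnInterval w 0 T :=
    absolutelyContinuousOnInterval_quadForm B (c := fun i s => c i s - c i t) fun i =>
      (hc i).fun_sub (absolutelyContinuousOnInterval_const _ _ _)
  have hle := abelInt_deriv_nonpos h0 h1 htm.1
    (hwac.mono (by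
      rw [uIcc_of_le htm.1.le, uIcc_of_le hT]
      exact Icc_subset_Icc_right htm.2))
    (fun s => hpos _) (by simp [w, quadForm]) hwd (by rw [hderiv]; exact hint)
  rw [hderiv, hsum, Fintype.sum_option] at hle
  simp only [x, f, Option.elim, one_mul] at hle
  have h5 : ∑ b, -2 * (∑ a, B a b * c a t) * abelInt β (deriv (c b)) t
      = -(2 * ∑ b, (∑ a, B a b * c a t) * abelInt β (deriv (c b)) t) := by
    rw [Finset.mul_sum, ← Finset.sum_neg_distrib]
    exact Finset.sum_congr rfl fun b _ => by ring
  linarith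

/-! ### From fractional derivatives back to functions -/

/-- Representation of an absolutely continuous function by its fractional derivative. -/
lemma sub_eq_abelInt {β T : ℝ} (h0 : 0 < β) (h1 : β < 1) {w : ℝ → ℝ}
    (hw : AbsolutelyContinuousOnInterval w 0 T) {t : ℝ} (ht : t ∈ Icc 0 T) :
    Real.Gamma β * Real.Gamma (1 - β) * (w t - w 0) = abelInt (1 - β) (abelInt β (deriv w)) t := by
  have hsub : uIcc 0 t ⊆ uIcc 0 T := by
    rw [uIcc_of_le ht.1, uIcc_of_le (ht.1.trans ht.2)]
    exact Icc_subset_Icc_right ht.2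
  have hw' := hw.mono hsub
  rw [abelInt_abelInt h0 h1 ht.1 hw'.intervalIntegrable_deriv, hw'.integral_deriv_eq_sub]

lemma integral_abel_const {β t : ℝ} (h1 : β < 1) :
    ∫ s in (0 : ℝ)..t, (t - s) ^ (-β) = t ^ (1 - β) / (1 - β) := by
  rw [intervalIntegral.integral_comp_sub_left (fun x => x ^ (-β)) t, sub_self, sub_zero,
    integral_rpow (Or.inl (by linarith)), Real.zero_rpow (by linarith), sub_zero,
    neg_add_eq_sub]

lemma intervalIntegrable_abel_const {β t : ℝ} (h1 : β < 1) :
    IntervalIntegrable (fun s => (t - s) ^ (-β)) volume 0 t := by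
  have := (intervalIntegral.intervalIntegrable_rpow' (a := t) (b := 0) (r := -β)
    (by linarith)).comp_sub_left t
  simpa using this

/-- An upper bound for the fractional derivative bounds the growth of the function. -/
lemma sub_le_of_abelInt_deriv_le {β T K : ℝ} (h0 : 0 < β) (h1 : β < 1) (hK : 0 ≤ K) {w : ℝ → ℝ}
    (hw : AbsolutelyContinuousOnInterval w 0 T)
    (hle : ∀ᵐ t : ℝ, t ∈ Ioc 0 T → abelInt β (deriv w) t ≤ K) {t : ℝ} (ht : t ∈ Icc 0 T) :
    Real.Gamma β * Real.Gamma (1 - β) * (w t - w 0) ≤ K * (T ^ β / β) := by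
  rw [sub_eq_abelInt h0 h1 hw ht]
  have hsub : uIcc 0 t ⊆ uIcc 0 T := by
    rw [uIcc_of_le ht.1, uIcc_of_le (ht.1.trans ht.2)]
    exact Icc_subset_Icc_right ht.2
  have hint := intervalIntegrable_abel_abelInt h0 h1 ht.1 (hw.mono hsub).intervalIntegrable_deriv
  have h2 : abelInt (1 - β) (abelInt β (deriv w)) t
      ≤ ∫ s in (0 : ℝ)..t, (t - s) ^ (-(1 - β)) * K := by
    refine intervalIntegral.integral_mono_ae_restrict ht.1 hint
      ((intervalIntegrable_abel_const (by linarith)).mul_const K) ?_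
    have hne : ∀ᵐ s : ℝ, s ≠ 0 := by simp [ae_iff, measure_singleton]
    rw [EventuallyLE, ae_restrict_iff' measurableSet_Icc]
    filter_upwards [hle, hne] with s hs hs0 hst
    exact mul_le_mul_of_nonneg_left
      (hs ⟨lt_of_le_of_ne hst.1 (Ne.symm hs0), hst.2.trans ht.2⟩)
      (Real.rpow_nonneg (sub_nonneg.2 hst.2) _)
  refine h2.trans ?_
  rw [intervalIntegral.integral_mul_const, integral_abel_const (by linarith), sub_sub_cancel,
    mul_comm]
  have : t ^ β ≤ T ^ β := Real.rpow_le_rpow ht.1 ht.2 h0.le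
  gcongr

/-- Uniqueness: a fractional derivative can be read off from the fractional integral equation. -/
lemma abelInt_deriv_eq_of_abelInt_eq {β T : ℝ} (h0 : 0 < β) (h1 : β < 1) (hT : 0 ≤ T)
    {w f : ℝ → ℝ} (hw : AbsolutelyContinuousOnInterval w 0 T)
    (hf : IntervalIntegrable f volume 0 T)
    (hfi : ∀ t ∈ Icc 0 T, IntervalIntegrable (fun s => (t - s) ^ (-(1 - β)) * f s) volume 0 t)
    (heq : ∀ t ∈ Icc 0 T,
      Real.Gamma β * Real.Gamma (1 - β) * (w t - w 0) = abelInt (1 - β) f t) :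
    ∀ᵐ t : ℝ, t ∈ Ioc 0 T → abelInt β (deriv w) t = f t := by
  set g : ℝ → ℝ := fun t => abelInt β (deriv w) t - f t with hg
  have hgi : IntervalIntegrable g volume 0 T :=
    (intervalIntegrable_abelInt h0 h1 hT hw.intervalIntegrable_deriv).sub hf
  have hsub : ∀ {t}, t ∈ Icc 0 T → uIcc 0 t ⊆ uIcc 0 T := fun {t} ht => by
    rw [uIcc_of_le ht.1, uIcc_of_le (ht.1.trans ht.2)]
    exact Icc_subset_Icc_right ht.2
  have hzero : ∀ t ∈ Icc 0 T, abelInt (1 - β) g t = 0 := by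
    intro t ht
    have hint := intervalIntegrable_abel_abelInt h0 h1 ht.1
      (hw.mono (hsub ht)).intervalIntegrable_deriv
    have h2 := sub_eq_abelInt h0 h1 hw ht
    rw [heq t ht] at h2
    have h3 : abelInt (1 - β) g t = abelInt (1 - β) (abelInt β (deriv w)) t
        - abelInt (1 - β) f t := by
      simp only [abelInt, hg, mul_sub]
      exact intervalIntegral.integral_sub hint (hfi t ht)
    rw [h3, ← h2, sub_self]
  have hG : 0 < Real.Gamma β * Real.Gamma (1 - β) :=
    mul_pos (Real.Gamma_pos_of_pos h0) (Real.Gamma_pos_of_pos (sub_pos.2 h1))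
  have hprim : ∀ t ∈ Icc 0 T, ∫ s in (0 : ℝ)..t, g s = 0 := by
    intro t ht
    -- A second Abel integral, now of order `β`, turns the vanishing of the Abel integral of `g`
    -- into the vanishing of its primitive. Lebesgue differentiation then yields `g = 0` almost
    -- everywhere.
    have h2 := abelInt_abelInt (β := 1 - β) (by linarith) (by linarith) ht.1
      (hgi.mono_set (hsub ht))
    rw [sub_sub_cancel, mul_comm (Real.Gamma (1 - β))] at h2
    have h3 : abelInt β (abelInt (1 - β) g) t = 0 := by
      unfold abelInt
      rw [intervalIntegral.integral_congr (g := fun _ => (0 : ℝ))]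
      · simp
      · intro s hs
        have hs' := hsub ht hs
        rw [uIcc_of_le hT] at hs'
        have := hzero s hs'
        unfold abelInt at this
        simp only [this, mul_zero]
    rw [h3] at h2
    exact (mul_eq_zero.1 h2.symm).resolve_left hG.ne'
  have hne : ∀ᵐ t : ℝ, t ≠ T := by simp [ae_iff, measure_singleton]
  filter_upwards [hgi.ae_hasDerivAt_integral, hne] with t ht htT htm
  have htI : t ∈ uIcc 0 T := by
    rw [uIcc_of_le hT]
    exact ⟨htm.1.le, htm.2⟩
  have h2 := ht htI 0 left_mem_uIcc
  have h3 : HasDerivAt (fun x => ∫ s in (0 : ℝ)..x, g s) 0 t := by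
    refine (hasDerivAt_const t (0 : ℝ)).congr_of_eventuallyEq ?_
    filter_upwards [Ioo_mem_nhds htm.1 (lt_of_le_of_ne htm.2 htT)] with x hx
    exact hprim x ⟨hx.1.le, hx.2.le⟩
  exact sub_eq_zero.1 (h2.unique h3)

/-! ### One-sided projections on a cell -/

/-- `q` is the one-sided projection of `w` on `[a,b]`: it has degree at most `k`, `q - w` is
orthogonal to the polynomials of degree at most `k - 1`, and `q = w` at the point `c`. -/
structure IsCellProj (k : ℕ) (a b c : ℝ) (w : ℝ → ℝ) (q : ℝ[X]) : Prop where
  mem : q ∈ degreeLT ℝ (k + 1)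
  orth : ∀ v ∈ degreeLT ℝ k, ∫ x in a..b, (q.eval x - w x) * v.eval x = 0
  eval_eq : q.eval c = w c

/-- The polynomial with coefficient vector `v`. -/
def polyOf {n : ℕ} (v : Fin n → ℝ) : ℝ[X] := ∑ i, C (v i) * X ^ (i : ℕ)

lemma eval_polyOf {n : ℕ} (v : Fin n → ℝ) (x : ℝ) :
    (polyOf v).eval x = ∑ i, v i * x ^ (i : ℕ) := by
  simp [polyOf, eval_finsetSum]

lemma polyOf_mem {n : ℕ} (v : Fin n → ℝ) : polyOf v ∈ degreeLT ℝ n := by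
  refine Submodule.sum_mem _ fun i _ => ?_
  rw [mem_degreeLT]
  exact (degree_C_mul_X_pow_le _ _).trans_lt (by exact_mod_cast i.2)

lemma polyOf_coeff {n : ℕ} {q : ℝ[X]} (hq : q ∈ degreeLT ℝ n) :
    polyOf (fun i : Fin n => q.coeff i) = q := by
  rw [mem_degreeLT] at hq
  rw [polyOf, Fin.sum_univ_eq_sum_range (fun i => C (q.coeff i) * X ^ i) n]
  ext j
  simp only [finsetSum_coeff, coeff_C_mul, coeff_X_pow, mul_ite, mul_one, mul_zero]
  rw [Finset.sum_ite_eq]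
  split_ifs with h
  · rfl
  · rw [Finset.mem_range, not_lt] at h
    exact (coeff_eq_zero_of_degree_lt (hq.trans_le (by exact_mod_cast h))).symm

lemma exists_eval_ne_zero {a b : ℝ} (hab : a < b) {r : ℝ[X]} (hr : r ≠ 0) :
    ∃ x ∈ Ioo a b, r.eval x ≠ 0 := by
  by_contra h
  push Not at h
  exact hr (eq_zero_of_infinite_isRoot r ((Ioo_infinite hab).mono fun x hx => h x hx))

/-- The end point condition gives `q = (X - c) r` with `r` of degree at most `k - 1`. Testing with
`r` gives `∫ (x - c) r² = 0`, and `x - c` has constant sign because `c` is an end point. -/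
lemma IsCellProj.eq_zero {k : ℕ} {a b c : ℝ} (hab : a < b) (hc : c = a ∨ c = b) {q : ℝ[X]}
    (h : IsCellProj k a b c (fun _ => 0) q) : q = 0 := by
  obtain ⟨r, rfl⟩ := dvd_iff_isRoot.2 h.eval_eq
  by_contra hne
  have hr : r ≠ 0 := right_ne_zero_of_mul hne
  have hrk : r ∈ degreeLT ℝ k := by
    have h2 := h.mem
    rw [mem_degreeLT] at h2 ⊢
    rw [degree_mul, degree_X_sub_C, degree_eq_natDegree hr] at h2
    rw [degree_eq_natDegree hr]
    have h3 : 1 + r.natDegree < k + 1 := by exact_mod_cast h2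
    have h4 : r.natDegree < k := by omega
    exact_mod_cast h4
  have h2 := h.orth r hrk
  obtain ⟨x, hx, hrx⟩ := exists_eval_ne_zero hab hr
  rcases hc with rfl | rfl
  · have h3 : 0 < ∫ x in c..b, (((X - C c) * r).eval x - 0) * r.eval x := by
      refine intervalIntegral.integral_pos hab (by fun_prop) (fun y hy => ?_)
        ⟨x, Ioo_subset_Icc_self hx, ?_⟩
      · simp only [eval_mul, eval_sub, eval_X, eval_C, sub_zero, mul_assoc]
        exact mul_nonneg (sub_nonneg.2 hy.1.le) (mul_self_nonneg _)
      · simp only [eval_mul, eval_sub, eval_X, eval_C, sub_zero, mul_assoc]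
        exact mul_pos (sub_pos.2 hx.1) (mul_self_pos.2 hrx)
    exact h3.ne' h2
  · have h3 : 0 < ∫ x in a..c, -((((X - C c) * r).eval x - 0) * r.eval x) := by
      refine intervalIntegral.integral_pos hab (by fun_prop) (fun y hy => ?_)
        ⟨x, Ioo_subset_Icc_self hx, ?_⟩
      · simp only [eval_mul, eval_sub, eval_X, eval_C, sub_zero, mul_assoc]
        rw [← neg_mul, neg_sub]
        exact mul_nonneg (sub_nonneg.2 hy.2) (mul_self_nonneg _)
      · simp only [eval_mul, eval_sub, eval_X, eval_C, sub_zero, mul_assoc]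
        rw [← neg_mul, neg_sub]
        exact mul_pos (sub_pos.2 hx.2) (mul_self_pos.2 hrx)
    rw [intervalIntegral.integral_neg, h2, neg_zero] at h3
    exact lt_irrefl _ h3

lemma IsCellProj.sub {k : ℕ} {a b c : ℝ} {w w' : ℝ → ℝ} {q q' : ℝ[X]}
    (hab : a ≤ b) (hw : ContinuousOn w (Icc a b)) (hw' : ContinuousOn w' (Icc a b))
    (h : IsCellProj k a b c w q) (h' : IsCellProj k a b c w' q') :
    IsCellProj k a b c (fun x => w x - w' x) (q - q') := by
  refine ⟨Submodule.sub_mem _ h.mem h'.mem, fun v hv => ?_, ?_⟩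
  · rw [← uIcc_of_le hab] at hw hw'
    have e : ∀ x, ((q - q').eval x - (w x - w' x)) * v.eval x
        = (q.eval x - w x) * v.eval x - (q'.eval x - w' x) * v.eval x := by
      intro x
      rw [eval_sub]
      ring
    simp_rw [e]
    rw [intervalIntegral.integral_sub, h.orth v hv, h'.orth v hv, sub_zero]
    · exact (((q.continuous.continuousOn).sub hw).mul v.continuous.continuousOn).intervalIntegrable
    · exact (((q'.continuous.continuousOn).sub hw').mul
        v.continuous.continuousOn).intervalIntegrable
  · rw [eval_sub, h.eval_eq, h'.eval_eq]

/-- The moments and the end point value that determine the projection. -/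
def cellMoments (k : ℕ) (a b c : ℝ) : (Fin (k + 1) → ℝ) →ₗ[ℝ] (Fin k → ℝ) × ℝ where
  toFun v := (fun l => ∫ x in a..b, (polyOf v).eval x * x ^ (l : ℕ), (polyOf v).eval c)
  map_add' v w := by
    have e : polyOf (v + w) = polyOf v + polyOf w := by
      simp [polyOf, add_mul, Finset.sum_add_distrib]
    rw [e]
    refine Prod.ext (funext fun l => ?_) (by simp)
    simp only [eval_add, add_mul, Prod.fst_add, Pi.add_apply]
    exact intervalIntegral.integral_add (Continuous.intervalIntegrable (by fun_prop) _ _)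
      (Continuous.intervalIntegrable (by fun_prop) _ _)
  map_smul' r v := by
    have e : polyOf (r • v) = C r * polyOf v := by
      simp [polyOf, Finset.mul_sum, mul_assoc]
    rw [e]
    refine Prod.ext (funext fun l => ?_) (by simp)
    simp only [eval_mul, eval_C, mul_assoc, RingHom.id_apply, Prod.smul_fst, Pi.smul_apply,
      smul_eq_mul]
    exact intervalIntegral.integral_const_mul _ _

lemma integral_mul_eval_eq_zero {k : ℕ} {a b : ℝ} (hab : a ≤ b) {g : ℝ → ℝ}
    (hg : ContinuousOn g (Icc a b)) (h : ∀ l : Fin k, ∫ x in a..b, g x * x ^ (l : ℕ) = 0)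
    {v : ℝ[X]} (hv : v ∈ degreeLT ℝ k) : ∫ x in a..b, g x * v.eval x = 0 := by
  rw [← polyOf_coeff hv]
  simp_rw [eval_polyOf, Finset.mul_sum]
  rw [← uIcc_of_le hab] at hg
  rw [intervalIntegral.integral_finsetSum]
  · refine Finset.sum_eq_zero fun l _ => ?_
    have := h l
    simp_rw [mul_left_comm (g _)]
    rw [intervalIntegral.integral_const_mul, this, mul_zero]
  · intro l _
    exact (hg.mul (by fun_prop)).intervalIntegrable

lemma injective_cellMoments {k : ℕ} {a b c : ℝ} (hab : a < b) (hc : c = a ∨ c = b) :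
    Function.Injective (cellMoments k a b c) := by
  rw [injective_iff_map_eq_zero]
  intro v hv
  have h1 := congrArg Prod.fst hv
  have h2 := congrArg Prod.snd hv
  have h3 : IsCellProj k a b c (fun _ => 0) (polyOf v) := by
    refine ⟨polyOf_mem v, fun p hp => ?_, h2⟩
    simp only [sub_zero]
    exact integral_mul_eval_eq_zero hab.le (polyOf v).continuous.continuousOn
      (fun l => congrFun h1 l) hp
  have h4 := h3.eq_zero hab hc
  funext i
  have h5 := congrArg (fun p : ℝ[X] => p.coeff i) h4
  simpa [polyOf, finsetSum_coeff, coeff_X_pow, Fin.val_inj] using h5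

/-- The moments as a linear equivalence. -/
def cellMomentsEquiv (k : ℕ) {a b c : ℝ} (hab : a < b) (hc : c = a ∨ c = b) :
    (Fin (k + 1) → ℝ) ≃ₗ[ℝ] (Fin k → ℝ) × ℝ :=
  LinearMap.linearEquivOfInjective (cellMoments k a b c) (injective_cellMoments hab hc) (by simp)

lemma cellMomentsEquiv_apply (k : ℕ) {a b c : ℝ} (hab : a < b) (hc : c = a ∨ c = b)
    (v : Fin (k + 1) → ℝ) : cellMomentsEquiv k hab hc v = cellMoments k a b c v := rfl

/-- Existence of the projection, with explicit linear functionals as coefficients. -/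
lemma exists_isCellProj (k : ℕ) {a b c : ℝ} (hab : a < b) (hc : c = a ∨ c = b) :
    ∃ (ψ : Fin (k + 1) → ℝ[X]) (β : Fin (k + 1) → ℝ), ∀ w : ℝ → ℝ, ContinuousOn w (Icc a b) →
      IsCellProj k a b c w
        (polyOf fun i => (∫ x in a..b, w x * (ψ i).eval x) + β i * w c) := by
  -- The unit vectors of moment space are sent to coefficient vectors by the inverse map; these
  -- supply `ψ` and `β`. The explicit formula is what later lets time derivatives pass through the
  -- projection.
  let e := (cellMomentsEquiv k hab hc).symm
  refine ⟨fun i => polyOf fun l => e (Pi.single l 1, 0) i, fun i => e (0, 1) i, fun w hw => ?_⟩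
  have hw' := hw
  rw [← uIcc_of_le hab.le] at hw'
  set z : (Fin k → ℝ) × ℝ := (fun l => ∫ x in a..b, w x * x ^ (l : ℕ), w c) with hz
  have hcoef : (fun i => (∫ x in a..b, w x * (polyOf fun l => e (Pi.single l 1, 0) i).eval x)
      + e (0, 1) i * w c) = e z := by
    have hz2 : z = (∑ l, z.1 l • ((Pi.single l 1, 0) : (Fin k → ℝ) × ℝ)) + z.2 • (0, 1) := by
      refine Prod.ext ?_ ?_
      · simp only [Prod.fst_add, Prod.fst_sum, Prod.smul_fst, smul_zero, add_zero]
        exact pi_eq_sum_univ' _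
      · simp [Prod.snd_sum]
    rw [hz2, map_add, map_sum, map_smul]
    funext i
    simp only [map_smul, Pi.add_apply, Finset.sum_apply, Pi.smul_apply, smul_eq_mul]
    rw [mul_comm (e (0, 1) i)]
    congr 1
    simp_rw [eval_polyOf, Finset.mul_sum]
    rw [intervalIntegral.integral_finsetSum]
    · refine Finset.sum_congr rfl fun l _ => ?_
      simp_rw [mul_left_comm (w _)]
      rw [intervalIntegral.integral_const_mul, mul_comm]
    · intro l _
      exact (hw'.mul (by fun_prop)).intervalIntegrable
  rw [hcoef]
  have hm : cellMoments k a b c (e z) = z := by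
    rw [← cellMomentsEquiv_apply k hab hc]
    exact LinearEquiv.apply_symm_apply _ _
  refine ⟨polyOf_mem _, fun v hv => ?_, congrArg Prod.snd hm⟩
  refine integral_mul_eval_eq_zero (g := fun x => (polyOf (e z)).eval x - w x) hab.le
    ((polyOf _).continuous.continuousOn.sub hw) ?_ hv
  intro l
  have h1 := congrFun (congrArg Prod.fst hm) l
  simp_rw [sub_mul]
  rw [intervalIntegral.integral_sub, sub_eq_zero]
  · exact h1
  · exact Continuous.intervalIntegrable (by fun_prop) _ _
  · exact (hw'.mul (by fun_prop)).intervalIntegrable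

/-- A polynomial is bounded on the reference cell by its moments and an end point value. -/
lemma exists_bound_of_moments (k : ℕ) {σ : ℝ} (hσ : σ = 0 ∨ σ = 1) :
    ∃ K : ℝ, 0 ≤ K ∧ ∀ p ∈ degreeLT ℝ (k + 1), ∀ m : ℝ, 0 ≤ m →
      (∀ l : Fin k, |∫ x in (0 : ℝ)..1, p.eval x * x ^ (l : ℕ)| ≤ m) → |p.eval σ| ≤ m →
      ∀ y ∈ Icc (0 : ℝ) 1, |p.eval y| ≤ K * m := by
  -- In finite dimension the inverse of the moment map is bounded. Its norm on `[0,1]` depends only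
  -- on `k` and `σ`.
  let e := LinearMap.toContinuousLinearMap
    (cellMomentsEquiv k (zero_lt_one' ℝ) hσ).symm.toLinearMap
  refine ⟨(k + 1) * ‖e‖, by positivity, fun p hp m hm hl hs y hy => ?_⟩
  set v : Fin (k + 1) → ℝ := fun i => p.coeff i with hv
  have hpv : polyOf v = p := polyOf_coeff hp
  have hve : v = e (cellMoments k 0 1 σ v) :=
    ((cellMomentsEquiv k (zero_lt_one' ℝ) hσ).symm_apply_apply v).symm
  have hnorm : ‖cellMoments k 0 1 σ v‖ ≤ m := by
    rw [Prod.norm_def]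
    refine max_le ((pi_norm_le_iff_of_nonneg hm).2 fun l => ?_) ?_
    · simpa [cellMoments, hpv] using hl l
    · simpa [cellMoments, hpv] using hs
  have hvn : ‖v‖ ≤ ‖e‖ * m := by
    rw [hve]
    exact (e.le_opNorm _).trans (by gcongr)
  rw [← hpv, eval_polyOf]
  calc |∑ i, v i * y ^ (i : ℕ)| ≤ ∑ i, |v i * y ^ (i : ℕ)| := Finset.abs_sum_le_sum_abs _ _
    _ ≤ ∑ _i : Fin (k + 1), ‖e‖ * m := by
      refine Finset.sum_le_sum fun i _ => ?_
      rw [abs_mul, abs_of_nonneg (pow_nonneg hy.1 _)]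
      have h1 : |v i| ≤ ‖e‖ * m := (norm_le_pi_norm v i).trans hvn
      have h2 : y ^ (i : ℕ) ≤ 1 := pow_le_one₀ hy.1 hy.2
      calc |v i| * y ^ (i : ℕ) ≤ |v i| * 1 := by gcongr
        _ ≤ _ := by rw [mul_one]; exact h1
    _ = (k + 1) * ‖e‖ * m := by simp [mul_assoc]

/-- Stability of the projection in the maximum norm, uniformly in the cell. -/
lemma exists_isCellProj_bound (k : ℕ) {σ : ℝ} (hσ : σ = 0 ∨ σ = 1) :
    ∃ K : ℝ, 0 ≤ K ∧ ∀ (a b c : ℝ), a < b → c = a + (b - a) * σ → ∀ (w : ℝ → ℝ) (q : ℝ[X]) (m : ℝ),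
      0 ≤ m → ContinuousOn w (Icc a b) → (∀ x ∈ Icc a b, |w x| ≤ m) → IsCellProj k a b c w q →
      ∀ x ∈ Icc a b, |q.eval x| ≤ K * m := by
  obtain ⟨K, hK, h⟩ := exists_bound_of_moments k hσ
  refine ⟨K, hK, fun a b c hab hc w q m hm hw hwm hq x hx => ?_⟩
  have hba : 0 < b - a := sub_pos.2 hab
  -- Pull-back to the reference cell. Moments scale with the cell length and end points go to end
  -- points, so the constant does not see the cell.
  set p : ℝ[X] := q.comp (C a + C (b - a) * X) with hp
  have hpe : ∀ y, p.eval y = q.eval (a + (b - a) * y) := fun y => by simp [hp]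
  have hpm : p ∈ degreeLT ℝ (k + 1) := by
    have h2 := hq.mem
    rw [degreeLT_succ_eq_degreeLE, mem_degreeLE] at h2 ⊢
    have h4 : p.natDegree ≤ k := by
      refine natDegree_comp_le.trans ?_
      have h3 : (C a + C (b - a) * X : ℝ[X]).natDegree ≤ 1 := by compute_degree
      calc _ ≤ k * 1 := Nat.mul_le_mul (natDegree_le_iff_degree_le.2 h2) h3
        _ = k := mul_one k
    exact natDegree_le_iff_degree_le.1 h4
  have hcm : c ∈ Icc a b := by
    rcases hσ with rfl | rfl
    · simp [hc, hab.le]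
    · simp [hc, hab.le]
  have key := h p hpm m hm (fun l => ?_) (by
    rw [hpe, ← hc, hq.eval_eq]
    exact hwm c hcm) ((x - a) / (b - a)) ⟨div_nonneg (sub_nonneg.2 hx.1) hba.le,
      (div_le_one hba).2 (by linarith [hx.2])⟩
  · rw [hpe] at key
    rwa [mul_div_cancel₀ _ hba.ne', add_sub_cancel] at key
  · set v : ℝ[X] := (C (b - a)⁻¹ * (X - C a)) ^ (l : ℕ) with hv
    have hve : ∀ x, v.eval x = ((x - a) / (b - a)) ^ (l : ℕ) := fun x => by
      simp [hv, div_eq_inv_mul]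
    have hvm : v ∈ degreeLT ℝ k := by
      rw [mem_degreeLT]
      have h5 : v.natDegree ≤ l := by
        refine natDegree_pow_le.trans ?_
        have h3 : (C (b - a)⁻¹ * (X - C a) : ℝ[X]).natDegree ≤ 1 := by compute_degree
        calc _ ≤ (l : ℕ) * 1 := Nat.mul_le_mul le_rfl h3
          _ = l := mul_one _
      exact (natDegree_le_iff_degree_le.1 h5).trans_lt (by exact_mod_cast l.2)
    have h2 : ∫ y in (0 : ℝ)..1, p.eval y * y ^ (l : ℕ)
        = (b - a)⁻¹ * ∫ x in a..b, q.eval x * v.eval x := by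
      have h3 := intervalIntegral.integral_comp_add_mul (a := 0) (b := 1)
        (fun x => q.eval x * v.eval x) hba.ne' a
      rw [mul_zero, mul_one, add_zero, add_sub_cancel, smul_eq_mul] at h3
      rw [← h3]
      refine intervalIntegral.integral_congr fun y _ => ?_
      simp only [hpe, hve]
      rw [add_sub_cancel_left, mul_div_cancel_left₀ _ hba.ne']
    have h4 : ∫ x in a..b, q.eval x * v.eval x = ∫ x in a..b, w x * v.eval x := by
      have h5 := hq.orth v hvm
      simp_rw [sub_mul] at h5
      rw [intervalIntegral.integral_sub, sub_eq_zero] at h5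
      · exact h5
      · exact Continuous.intervalIntegrable (by fun_prop) _ _
      · rw [← uIcc_of_le hab.le] at hw
        exact (hw.mul (by fun_prop)).intervalIntegrable
    have h6 : ‖∫ x in a..b, w x * v.eval x‖ ≤ m * |b - a| := by
      refine intervalIntegral.norm_integral_le_of_norm_le_const fun x hx => ?_
      rw [uIoc_of_le hab.le] at hx
      have h7 : 0 ≤ (x - a) / (b - a) := div_nonneg (sub_nonneg.2 hx.1.le) hba.le
      have h8 : (x - a) / (b - a) ≤ 1 := (div_le_one hba).2 (by linarith [hx.2])
      rw [hve, norm_mul, Real.norm_eq_abs, Real.norm_of_nonneg (pow_nonneg h7 _)]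
      calc |w x| * ((x - a) / (b - a)) ^ (l : ℕ) ≤ m * 1 :=
            mul_le_mul (hwm x (Ioc_subset_Icc_self hx)) (pow_le_one₀ h7 h8) (pow_nonneg h7 _) hm
        _ = m := mul_one m
    rw [h2, h4, abs_mul, abs_of_pos (inv_pos.2 hba)]
    rw [abs_of_pos hba, Real.norm_eq_abs] at h6
    rw [inv_mul_le_iff₀ hba, mul_comm]
    exact h6

/-- Approximation property of the projection, uniformly in the cell. -/
lemma exists_isCellProj_error (k : ℕ) {σ : ℝ} (hσ : σ = 0 ∨ σ = 1) :
    ∃ K : ℝ, 0 ≤ K ∧ ∀ (a b c : ℝ), a < b → c = a + (b - a) * σ → ∀ (w : ℝ → ℝ) (q : ℝ[X]) (m : ℝ),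
      0 ≤ m → ContDiff ℝ ((k + 1 : ℕ) : WithTop ℕ∞) w →
      (∀ x ∈ Icc a b, |iteratedDeriv (k + 1) w x| ≤ m) → IsCellProj k a b c w q →
      ∀ x ∈ Icc a b, |w x - q.eval x| ≤ K * (m * (b - a) ^ (k + 1)) := by
  obtain ⟨K, hK, h⟩ := exists_isCellProj_bound k hσ
  refine ⟨1 + K, by positivity, fun a b c hab hc w q m hm hw hwm hq x hx => ?_⟩
  have hba : 0 < b - a := sub_pos.2 hab
  -- The Taylor polynomial of degree `k` at `a`. It is its own projection, so `w - q` is the Taylor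
  -- remainder minus the projection of that remainder, and maximum norm stability applies.
  set τ : ℝ[X] := ∑ i ∈ Finset.range (k + 1),
    C ((i.factorial : ℝ)⁻¹ * iteratedDerivWithin i w (Icc a b) a) * (X - C a) ^ i with hτ
  have hτe : ∀ y, τ.eval y = taylorWithinEval w k (Icc a b) a y := by
    intro y
    rw [taylor_within_apply, hτ, eval_finsetSum]
    refine Finset.sum_congr rfl fun i _ => ?_
    simp
    ring
  have hτm : τ ∈ degreeLT ℝ (k + 1) := by
    refine Submodule.sum_mem _ fun i hi => ?_
    rw [mem_degreeLT]
    have h5 : (C ((i.factorial : ℝ)⁻¹ * iteratedDerivWithin i w (Icc a b) a)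
        * (X - C a) ^ i).natDegree ≤ i := by
      refine (natDegree_C_mul_le _ _).trans ?_
      rw [natDegree_pow, natDegree_X_sub_C, mul_one]
    exact (natDegree_le_iff_degree_le.1 h5).trans_lt (by exact_mod_cast Finset.mem_range.1 hi)
  have hrem : ∀ y ∈ Icc a b, |w y - τ.eval y| ≤ m * (b - a) ^ (k + 1) := by
    intro y hy
    have h2 := taylor_mean_remainder_bound (f := w) (n := k) (C := m) hab.le
      (by exact_mod_cast hw.contDiffOn) hy (fun z hz => by
        rw [iteratedDerivWithin_eq_iteratedDeriv (uniqueDiffOn_Icc hab) hw.contDiffAt hz]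
        exact hwm z hz)
    rw [← hτe] at h2
    refine h2.trans ((div_le_self ?_ (by exact_mod_cast k.factorial_pos)).trans ?_)
    · exact mul_nonneg hm (pow_nonneg (sub_nonneg.2 hy.1) _)
    · have := sub_nonneg.2 hy.1
      have := hy.2
      gcongr
  have hτp : IsCellProj k a b c (fun y => τ.eval y) τ :=
    ⟨hτm, fun v _ => by simp, rfl⟩
  have hs := hq.sub hab.le hw.continuous.continuousOn τ.continuous.continuousOn hτp
  have h2 := h a b c hab hc _ _ (m * (b - a) ^ (k + 1)) (by positivity)
    (hw.continuous.sub τ.continuous).continuousOn hrem hs x hx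
  have h3 := hrem x hx
  rw [eval_sub] at h2
  calc |w x - q.eval x| = |(w x - τ.eval x) - (q.eval x - τ.eval x)| := by ring_nf
    _ ≤ |w x - τ.eval x| + |q.eval x - τ.eval x| := abs_sub _ _
    _ ≤ _ := by linarith

/-! ### Mesh geometry and periodic numbering -/

namespace Mesh

variable {L : ℝ} (M : Mesh L)

lemma left_lt_right (j : Fin M.N) : M.left j < M.right j :=
  M.strictMono Fin.castSucc_lt_succ

lemma left_mem (j : Fin M.N) : M.left j ∈ Icc 0 L := by
  refine ⟨?_, ?_⟩
  · rw [← M.node_zero]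
    exact M.strictMono.monotone (Fin.zero_le _)
  · exact (M.strictMono.monotone (Fin.le_last _)).trans_eq M.node_last

lemma right_mem (j : Fin M.N) : M.right j ∈ Icc 0 L := by
  refine ⟨?_, ?_⟩
  · rw [← M.node_zero]
    exact M.strictMono.monotone (Fin.zero_le _)
  · exact (M.strictMono.monotone (Fin.le_last _)).trans_eq M.node_last

lemma cell_subset (j : Fin M.N) : Icc (M.left j) (M.right j) ⊆ Icc 0 L :=
  Icc_subset_Icc (M.left_mem j).1 (M.right_mem j).2

lemma length_le_h (j : Fin M.N) : M.right j - M.left j ≤ M.h :=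
  le_ciSup (f := fun j => M.right j - M.left j) (Set.finite_range _).bddAbove j

lemma h_pos : 0 < M.h :=
  (sub_pos.2 (M.left_lt_right ⟨0, M.N_pos⟩)).trans_le (M.length_le_h _)

lemma sum_succ_sub_castSucc : ∀ (n : ℕ) (f : Fin (n + 1) → ℝ),
    ∑ j : Fin n, (f j.succ - f j.castSucc) = f (Fin.last n) - f 0
  | 0, f => by simp
  | n + 1, f => by
    rw [Fin.sum_univ_castSucc]
    have := sum_succ_sub_castSucc n fun i => f i.castSucc
    simp only [← Fin.succ_castSucc, Fin.castSucc_zero] at this ⊢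
    rw [this, Fin.succ_last]
    ring

lemma sum_length : ∑ j, (M.right j - M.left j) = L := by
  have := sum_succ_sub_castSucc M.N M.node
  rw [M.node_last, M.node_zero, sub_zero] at this
  exact this

/-- Periodic functions take the same value on both sides of a periodically identified node. -/
lemma apply_left_finRotate {f : ℝ → ℝ} (hf : f L = f 0) (j : Fin M.N) :
    f (M.left (finRotate M.N j)) = f (M.right j) := by
  obtain ⟨N, hN, node, hmono, h0, hlast⟩ := M
  cases N with
  | zero => exact absurd hN (lt_irrefl 0)
  | succ n =>
    simp only [left, right]
    by_cases h : j = Fin.last n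
    · subst h
      rw [finRotate_last, Fin.castSucc_zero, h0, Fin.succ_last, hlast, hf]
    · congr 2
      ext
      simp only [Fin.val_castSucc, Fin.val_succ]
      exact coe_finRotate_of_ne_last h

lemma apply_right_finRotate_symm {f : ℝ → ℝ} (hf : f L = f 0) (j : Fin M.N) :
    f (M.right ((finRotate M.N).symm j)) = f (M.left j) := by
  have := M.apply_left_finRotate hf ((finRotate M.N).symm j)
  rw [Equiv.apply_symm_apply] at this
  exact this.symm

variable {M} {k : ℕ}

lemma continuous_val (v : M.Space k) (j : Fin M.N) : Continuous (val v j) :=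
  (v j : ℝ[X]).continuous

lemma sum_integral_sq_le {f : Fin M.N → ℝ → ℝ} {E : ℝ}
    (hf : ∀ j, ∀ x ∈ Icc (M.left j) (M.right j), |f j x| ≤ E) :
    ∑ j, ∫ x in (M.left j)..(M.right j), f j x ^ 2 ≤ L * E ^ 2 := by
  calc ∑ j, ∫ x in (M.left j)..(M.right j), f j x ^ 2
      ≤ ∑ j, (M.right j - M.left j) * E ^ 2 := by
        refine Finset.sum_le_sum fun j _ => ?_
        have h1 := intervalIntegral.norm_integral_le_of_norm_le_const
          (a := M.left j) (b := M.right j) (f := fun x => f j x ^ 2) (C := E ^ 2) fun x hx => by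
            rw [uIoc_of_le (M.left_lt_right j).le] at hx
            rw [norm_pow, Real.norm_eq_abs]
            exact pow_le_pow_left₀ (abs_nonneg _) (hf j x (Ioc_subset_Icc_self hx)) 2
        rw [abs_of_pos (sub_pos.2 (M.left_lt_right j)), mul_comm] at h1
        exact (le_abs_self _).trans h1
    _ = L * E ^ 2 := by rw [← Finset.sum_mul, M.sum_length]

end Mesh

/-! ### Energy analysis in space at a fixed time -/

lemma derivative_mem_degreeLT {k : ℕ} {p : ℝ[X]} (hp : p ∈ degreeLT ℝ (k + 1)) :
    derivative p ∈ degreeLT ℝ k := by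
  by_cases h : p.natDegree = 0
  · rw [eq_C_of_natDegree_eq_zero h, derivative_C]
    exact Submodule.zero_mem _
  · rw [mem_degreeLT] at hp ⊢
    have hp0 : p ≠ 0 := fun h' => h (by rw [h', natDegree_zero])
    rw [degree_eq_natDegree hp0] at hp
    have h1 : p.natDegree < k + 1 := by exact_mod_cast hp
    have h2 := natDegree_derivative_lt h
    refine (degree_le_natDegree).trans_lt ?_
    have h3 : p.derivative.natDegree < k := by omega
    exact_mod_cast h3

lemma integral_parts_polynomial {a b : ℝ} {f f' : ℝ → ℝ} (hf : ∀ x, HasDerivAt f (f' x) x)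
    (hf' : Continuous f') (p : ℝ[X]) :
    (∫ x in a..b, f' x * p.eval x) + ∫ x in a..b, f x * (derivative p).eval x
      = f b * p.eval b - f a * p.eval a := by
  have hc : Continuous f := continuous_iff_continuousAt.2 fun x => (hf x).continuousAt
  rw [← intervalIntegral.integral_add (Continuous.intervalIntegrable (by fun_prop) _ _)
    (Continuous.intervalIntegrable (by fun_prop) _ _)]
  exact intervalIntegral.integral_deriv_mul_eq_sub (fun x _ => hf x) (fun x _ => p.hasDerivAt x)
    (hf'.intervalIntegrable _ _) ((derivative p).continuous.intervalIntegrable _ _)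

/-- Energy identity of the spatial discretisation at a fixed time. -/
lemma energy_identity {L : ℝ} {M : Mesh L} {k : ℕ} (κ : ℝ) {w w₁ w₂ : ℝ → ℝ}
    (hw : ∀ x, HasDerivAt w (w₁ x) x) (hw₁ : ∀ x, HasDerivAt w₁ (w₂ x) x) (hw₂ : Continuous w₂)
    (hper : w L = w 0) (hper₁ : w₁ L = w₁ 0) (uh ph : M.Space k) {Q : Fin M.N → ℝ → ℝ}
    (hQ : ∀ j, Continuous (Q j)) {q r : Fin M.N → ℝ[X]}
    (hq : ∀ j, IsCellProj k (M.left j) (M.right j) (M.right j) w (q j))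
    (hr : ∀ j, IsCellProj k (M.left j) (M.right j) (M.left j) w₁ (r j))
    (h1 : ∀ (v : M.Space k) (j : Fin M.N),
      (∫ x in (M.left j)..(M.right j), Q j x * Mesh.val v j x) +
        κ * ((∫ x in (M.left j)..(M.right j), Mesh.val ph j x * (derivative (v j : ℝ[X])).eval x)
          - Mesh.plusRight ph j * Mesh.val v j (M.right j)
          + Mesh.plusLeft ph j * Mesh.val v j (M.left j)) = 0)
    (h2 : ∀ (v : M.Space k) (j : Fin M.N),
      (∫ x in (M.left j)..(M.right j), Mesh.val ph j x * Mesh.val v j x) +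
        (∫ x in (M.left j)..(M.right j), Mesh.val uh j x * (derivative (v j : ℝ[X])).eval x)
          - Mesh.minusRight uh j * Mesh.val v j (M.right j)
          + Mesh.minusLeft uh j * Mesh.val v j (M.left j) = 0) :
    (∑ j, ∫ x in (M.left j)..(M.right j), (κ * w₂ x - Q j x) * ((q j).eval x - Mesh.val uh j x))
      + κ * ∑ j, ∫ x in (M.left j)..(M.right j),
          (w₁ x - Mesh.val ph j x) * ((r j).eval x - Mesh.val ph j x) = 0 := by
  have hcw : Continuous w := continuous_iff_continuousAt.2 fun x => (hw x).continuousAt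
  have hcw₁ : Continuous w₁ := continuous_iff_continuousAt.2 fun x => (hw₁ x).continuousAt
  -- The test functions are the discrete errors. Their derivatives have degree at most `k - 1`,
  -- which is what the orthogonality of the projections needs.
  set ξ : M.Space k := fun j => ⟨q j, (hq j).mem⟩ - uh j with hξ
  set ρ : M.Space k := fun j => ⟨r j, (hr j).mem⟩ - ph j with hρ
  have hξv : ∀ j x, (ξ j : ℝ[X]).eval x = (q j).eval x - (uh j : ℝ[X]).eval x := fun j x => by
    simp [hξ]
  have hρv : ∀ j x, (ρ j : ℝ[X]).eval x = (r j).eval x - (ph j : ℝ[X]).eval x := fun j x => by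
    simp [hρ]
  let ρL : Fin M.N → ℝ := fun j => (ρ j : ℝ[X]).eval (M.left j)
  let ξR : Fin M.N → ℝ := fun j => (ξ j : ℝ[X]).eval (M.right j)
  -- Since `q` and `r` interpolate exactly at the nodes where the fluxes are taken, each flux error
  -- is a nodal value of `ξ` or `ρ`, and only products of such values survive on a cell.
  have key : ∀ j, (∫ x in (M.left j)..(M.right j),
        (κ * w₂ x - Q j x) * ((q j).eval x - Mesh.val uh j x))
      + κ * (∫ x in (M.left j)..(M.right j),
          (w₁ x - Mesh.val ph j x) * ((r j).eval x - Mesh.val ph j x))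
      = κ * (ρL (finRotate M.N j) * ξR j - ρL j * ξR ((finRotate M.N).symm j)) := by
    intro j
    have e1 := h1 ξ j
    have e2 := h2 ρ j
    have p1 := integral_parts_polynomial (a := M.left j) (b := M.right j) hw₁ hw₂ (ξ j : ℝ[X])
    have p2 := integral_parts_polynomial (a := M.left j) (b := M.right j) hw hcw₁ (ρ j : ℝ[X])
    have p3 := integral_parts_polynomial (a := M.left j) (b := M.right j)
      (fun x => (ρ j : ℝ[X]).hasDerivAt x) (derivative (ρ j : ℝ[X])).continuous (ξ j : ℝ[X])
    have o1 := (hr j).orth _ (derivative_mem_degreeLT (ξ j).2)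
    have o2 := (hq j).orth _ (derivative_mem_degreeLT (ρ j).2)
    have b1 : Mesh.plusRight ph j = w₁ (M.right j) - ρL (finRotate M.N j) := by
      simp only [ρL, hρv, (hr _).eval_eq, M.apply_left_finRotate hper₁, Mesh.plusRight,
        Mesh.plusLeft, Mesh.val]
      ring
    have b2 : Mesh.plusLeft ph j = w₁ (M.left j) - ρL j := by
      simp only [ρL, hρv, (hr _).eval_eq, Mesh.plusLeft, Mesh.val]
      ring
    have b3 : Mesh.minusRight uh j = w (M.right j) - ξR j := by
      simp only [ξR, hξv, (hq _).eval_eq, Mesh.minusRight, Mesh.val]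
      ring
    have b4 : Mesh.minusLeft uh j = w (M.left j) - ξR ((finRotate M.N).symm j) := by
      simp only [ξR, hξv, (hq _).eval_eq, M.apply_right_finRotate_symm hper, Mesh.minusLeft,
        Mesh.minusRight, Mesh.val]
      ring
    rw [b1, b2] at e1
    rw [b3, b4] at e2
    simp only [Mesh.val] at e1 e2 ⊢
    have i1 : ∫ x in (M.left j)..(M.right j), (κ * w₂ x - Q j x) * ((q j).eval x
          - (uh j : ℝ[X]).eval x)
        = κ * (∫ x in (M.left j)..(M.right j), w₂ x * (ξ j : ℝ[X]).eval x)
          - ∫ x in (M.left j)..(M.right j), Q j x * (ξ j : ℝ[X]).eval x := by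
      have := hQ j
      rw [← intervalIntegral.integral_const_mul, ← intervalIntegral.integral_sub
        (Continuous.intervalIntegrable (by fun_prop) _ _)
        (Continuous.intervalIntegrable (by fun_prop) _ _)]
      refine intervalIntegral.integral_congr fun x _ => ?_
      simp only [hξv]
      ring
    have i2 : ∫ x in (M.left j)..(M.right j), (w₁ x - (ph j : ℝ[X]).eval x) * ((r j).eval x
          - (ph j : ℝ[X]).eval x)
        = (∫ x in (M.left j)..(M.right j), w₁ x * (ρ j : ℝ[X]).eval x)
          - ∫ x in (M.left j)..(M.right j), (ph j : ℝ[X]).eval x * (ρ j : ℝ[X]).eval x := by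
      rw [← intervalIntegral.integral_sub
        (Continuous.intervalIntegrable (by fun_prop) _ _)
        (Continuous.intervalIntegrable (by fun_prop) _ _)]
      refine intervalIntegral.integral_congr fun x _ => ?_
      simp only [hρv]
      ring
    have i3 : (∫ x in (M.left j)..(M.right j),
          ((r j).eval x - w₁ x) * (derivative (ξ j : ℝ[X])).eval x)
        = (∫ x in (M.left j)..(M.right j), (ρ j : ℝ[X]).eval x * (derivative (ξ j : ℝ[X])).eval x)
          + (∫ x in (M.left j)..(M.right j),
              (ph j : ℝ[X]).eval x * (derivative (ξ j : ℝ[X])).eval x)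
          - ∫ x in (M.left j)..(M.right j), w₁ x * (derivative (ξ j : ℝ[X])).eval x := by
      rw [← intervalIntegral.integral_add
        (Continuous.intervalIntegrable (by fun_prop) _ _)
        (Continuous.intervalIntegrable (by fun_prop) _ _), ← intervalIntegral.integral_sub
        (Continuous.intervalIntegrable (by fun_prop) _ _)
        (Continuous.intervalIntegrable (by fun_prop) _ _)]
      refine intervalIntegral.integral_congr fun x _ => ?_
      simp only [hρv]
      ring
    have i4 : (∫ x in (M.left j)..(M.right j),
          ((q j).eval x - w x) * (derivative (ρ j : ℝ[X])).eval x)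
        = (∫ x in (M.left j)..(M.right j), (derivative (ρ j : ℝ[X])).eval x * (ξ j : ℝ[X]).eval x)
          + (∫ x in (M.left j)..(M.right j),
              (uh j : ℝ[X]).eval x * (derivative (ρ j : ℝ[X])).eval x)
          - ∫ x in (M.left j)..(M.right j), w x * (derivative (ρ j : ℝ[X])).eval x := by
      rw [← intervalIntegral.integral_add
        (Continuous.intervalIntegrable (by fun_prop) _ _)
        (Continuous.intervalIntegrable (by fun_prop) _ _), ← intervalIntegral.integral_sub
        (Continuous.intervalIntegrable (by fun_prop) _ _)
        (Continuous.intervalIntegrable (by fun_prop) _ _)]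
      refine intervalIntegral.integral_congr fun x _ => ?_
      simp only [hξv]
      ring
    rw [i1, i2]
    rw [i3] at o1
    rw [i4] at o2
    simp only [ρL, ξR] at *
    linear_combination κ * p1 + κ * p2 - e1 - κ * e2 - κ * p3 + κ * o1 + κ * o2
  -- The two sums agree after a cyclic shift of the index: each node contributes once from either
  -- side with opposite signs.
  have hsum : ∑ j, (ρL (finRotate M.N j) * ξR j - ρL j * ξR ((finRotate M.N).symm j)) = 0 := by
    rw [Finset.sum_sub_distrib, sub_eq_zero]
    have := Equiv.sum_comp (finRotate M.N) fun j => ρL j * ξR ((finRotate M.N).symm j)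
    simp only [Equiv.symm_apply_apply] at this
    exact this
  rw [Finset.mul_sum, ← Finset.sum_add_distrib, Finset.sum_congr rfl fun j _ => key j,
    ← Finset.mul_sum, hsum, mul_zero]

/-- Energy estimate of the spatial discretisation at a fixed time. -/
lemma energy_estimate {L : ℝ} {M : Mesh L} {k : ℕ} {κ δ : ℝ} (hκ : 0 < κ) (hδ : 0 < δ)
    {w w₁ w₂ : ℝ → ℝ}
    (hw : ∀ x, HasDerivAt w (w₁ x) x) (hw₁ : ∀ x, HasDerivAt w₁ (w₂ x) x) (hw₂ : Continuous w₂)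
    (hper : w L = w 0) (hper₁ : w₁ L = w₁ 0) (uh ph : M.Space k) {Q : Fin M.N → ℝ → ℝ}
    (hQ : ∀ j, Continuous (Q j)) {q r s : Fin M.N → ℝ[X]}
    (hq : ∀ j, IsCellProj k (M.left j) (M.right j) (M.right j) w (q j))
    (hr : ∀ j, IsCellProj k (M.left j) (M.right j) (M.left j) w₁ (r j))
    (h1 : ∀ (v : M.Space k) (j : Fin M.N),
      (∫ x in (M.left j)..(M.right j), Q j x * Mesh.val v j x) +
        κ * ((∫ x in (M.left j)..(M.right j), Mesh.val ph j x * (derivative (v j : ℝ[X])).eval x)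
          - Mesh.plusRight ph j * Mesh.val v j (M.right j)
          + Mesh.plusLeft ph j * Mesh.val v j (M.left j)) = 0)
    (h2 : ∀ (v : M.Space k) (j : Fin M.N),
      (∫ x in (M.left j)..(M.right j), Mesh.val ph j x * Mesh.val v j x) +
        (∫ x in (M.left j)..(M.right j), Mesh.val uh j x * (derivative (v j : ℝ[X])).eval x)
          - Mesh.minusRight uh j * Mesh.val v j (M.right j)
          + Mesh.minusLeft uh j * Mesh.val v j (M.left j) = 0)
    {E₁ E₂ : ℝ}
    (hE₁ : ∀ j, ∀ x ∈ Icc (M.left j) (M.right j), |w₁ x - (r j).eval x| ≤ E₁)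
    (hE₂ : ∀ j, ∀ x ∈ Icc (M.left j) (M.right j), |w₂ x - (s j).eval x| ≤ E₂) :
    (∑ j, ∫ x in (M.left j)..(M.right j),
        (κ * (s j).eval x - Q j x) * ((q j).eval x - Mesh.val uh j x))
      ≤ κ * (L * E₁ ^ 2 / 4 + L * E₂ ^ 2 / (4 * δ)
        + δ * ∑ j, ∫ x in (M.left j)..(M.right j), ((q j).eval x - Mesh.val uh j x) ^ 2) := by
  have hid := energy_identity κ hw hw₁ hw₂ hper hper₁ uh ph hQ hq hr h1 h2
  have hcw₁ : Continuous w₁ := continuous_iff_continuousAt.2 fun x => (hw₁ x).continuousAt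
  have hB1 := Mesh.sum_integral_sq_le hE₁
  have hB2 := Mesh.sum_integral_sq_le hE₂
  have hcell : ∀ j, (∫ x in (M.left j)..(M.right j),
        (κ * (s j).eval x - Q j x) * ((q j).eval x - Mesh.val uh j x))
      ≤ (∫ x in (M.left j)..(M.right j),
          (κ * w₂ x - Q j x) * ((q j).eval x - Mesh.val uh j x))
        + κ * (∫ x in (M.left j)..(M.right j),
          (w₁ x - Mesh.val ph j x) * ((r j).eval x - Mesh.val ph j x))
        + κ / 4 * (∫ x in (M.left j)..(M.right j), (w₁ x - (r j).eval x) ^ 2)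
        + κ / (4 * δ) * (∫ x in (M.left j)..(M.right j), (w₂ x - (s j).eval x) ^ 2)
        + κ * δ * ∫ x in (M.left j)..(M.right j), ((q j).eval x - Mesh.val uh j x) ^ 2 := by
    intro j
    have hc1 := Mesh.continuous_val uh j
    have hc2 := Mesh.continuous_val ph j
    have hc3 := hQ j
    simp only [← intervalIntegral.integral_const_mul]
    rw [← intervalIntegral.integral_add, ← intervalIntegral.integral_add,
      ← intervalIntegral.integral_add, ← intervalIntegral.integral_add]
    · refine intervalIntegral.integral_mono_on (M.left_lt_right j).le
        (Continuous.intervalIntegrable (by fun_prop) _ _)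
        (Continuous.intervalIntegrable (by fun_prop) _ _) fun x _ => ?_
      set X := (q j).eval x - Mesh.val uh j x
      set Y := w₂ x - (s j).eval x with hY
      set Z := w₁ x - (r j).eval x with hZ
      set R := (r j).eval x - Mesh.val ph j x with hR
      have e1 : (κ * w₂ x - Q j x) * X = (κ * (s j).eval x - Q j x) * X + κ * (Y * X) := by
        rw [hY]; ring
      have e2 : w₁ x - Mesh.val ph j x = Z + R := by rw [hZ, hR]; ring
      -- Completed squares for Young's inequality: `R²` absorbs `Z R` at the cost of `Z²/4`, and `Y
      -- X` is split with the free weight `δ`.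
      have e3 : 0 ≤ κ * (Z / 2 + R) ^ 2 := by positivity
      have e4 : 0 ≤ κ / (4 * δ) * (Y + 2 * δ * X) ^ 2 := by positivity
      have e5 : κ / (4 * δ) * (Y + 2 * δ * X) ^ 2
          = κ / (4 * δ) * Y ^ 2 + κ * (Y * X) + κ * δ * X ^ 2 := by
        field_simp
        ring
      rw [e1, e2]
      nlinarith [e3, e4, e5]
    all_goals exact Continuous.intervalIntegrable (by fun_prop) _ _
  have hs := Finset.sum_le_sum fun j (_ : j ∈ Finset.univ) => hcell j
  simp only [Finset.sum_add_distrib, ← Finset.mul_sum] at hs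
  rw [hid, zero_add] at hs
  refine hs.trans ?_
  have e1 : κ * (L * E₁ ^ 2 / 4 + L * E₂ ^ 2 / (4 * δ)
        + δ * ∑ j, ∫ x in (M.left j)..(M.right j), ((q j).eval x - Mesh.val uh j x) ^ 2)
      = κ / 4 * (L * E₁ ^ 2) + κ / (4 * δ) * (L * E₂ ^ 2)
        + κ * δ * ∑ j, ∫ x in (M.left j)..(M.right j), ((q j).eval x - Mesh.val uh j x) ^ 2 := by
    field_simp
  rw [e1]
  gcongr

/-! ### The tempered derivative and the time regularity of moments -/

lemma absolutelyContinuousOnInterval_congr {f g : ℝ → ℝ} {a b : ℝ}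
    (hf : AbsolutelyContinuousOnInterval f a b) (h : EqOn f g (uIcc a b)) :
    AbsolutelyContinuousOnInterval g a b := by
  rw [absolutelyContinuousOnInterval_iff] at hf ⊢
  intro ε hε
  obtain ⟨δ, hδ, h2⟩ := hf ε hε
  refine ⟨δ, hδ, fun E hE hlt => ?_⟩
  refine lt_of_eq_of_lt (Finset.sum_congr rfl fun i hi => ?_) (h2 E hE hlt)
  obtain ⟨h3, h4⟩ := hE.1 i hi
  rw [h h3, h h4]

lemma absolutelyContinuousOnInterval_exp (lam a b : ℝ) :
    AbsolutelyContinuousOnInterval (fun t => Real.exp (lam * t)) a b :=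
  absolutelyContinuousOnInterval_of_contDiffOn
    (Real.contDiff_exp.comp (contDiff_const.mul contDiff_id)).contDiffOn

lemma abelInt_deriv_exp_mul {α lam t : ℝ} (hα₁ : α < 1) (w : ℝ → ℝ) :
    abelInt α (deriv fun r => Real.exp (lam * r) * w r) t
      = Real.Gamma (1 - α) * Real.exp (lam * t) * caputoTempered α lam w t := by
  have hG := (Real.Gamma_pos_of_pos (sub_pos.2 hα₁)).ne'
  unfold caputoTempered abelInt
  rw [neg_mul, Real.exp_neg]
  have := Real.exp_ne_zero (lam * t)
  field_simp

variable {α lam κ L T : ℝ} {k : ℕ} {u₀ : ℝ → ℝ} {u : ℝ → ℝ → ℝ}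

namespace IsRegularSolution

lemma absCont_exp_mul (hu : IsRegularSolution α lam κ L T k u₀ u) (x : ℝ) :
    AbsolutelyContinuousOnInterval (fun t => Real.exp (lam * t) * u x t) 0 T :=
  (absolutelyContinuousOnInterval_exp lam 0 T).fun_mul (hu.absCont_time x)

lemma ae_abelInt_deriv (hu : IsRegularSolution α lam κ L T k u₀ u) (hα₁ : α < 1) (x : ℝ) :
    ∀ᵐ t : ℝ, t ∈ Ioc 0 T → abelInt α (deriv fun r => Real.exp (lam * r) * u x r) t
      = Real.Gamma (1 - α) * κ * (Real.exp (lam * t) * iteratedDeriv 2 (fun y => u y t) x) := by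
  filter_upwards [hu.equation x] with t ht htm
  rw [abelInt_deriv_exp_mul hα₁, ht htm]
  ring

/-- The integrated equation holds at every `t`, without the `x`-dependent null set of the
differential form, so it can be integrated over `x`. -/
lemma abelInt_eq (hu : IsRegularSolution α lam κ L T k u₀ u) (hα₀ : 0 < α) (hα₁ : α < 1) (x : ℝ)
    {t : ℝ} (ht : t ∈ Icc 0 T) :
    Real.Gamma α * Real.Gamma (1 - α)
        * (Real.exp (lam * t) * u x t - Real.exp (lam * 0) * u x 0)
      = abelInt (1 - α) (fun s => Real.Gamma (1 - α) * κ
          * (Real.exp (lam * s) * iteratedDeriv 2 (fun y => u y s) x)) t := by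
  rw [sub_eq_abelInt hα₀ hα₁ (hu.absCont_exp_mul x) ht]
  refine intervalIntegral.integral_congr_ae ?_
  filter_upwards [hu.ae_abelInt_deriv hα₁ x] with s hs hst
  rw [uIoc_of_le ht.1] at hst
  rw [hs ⟨hst.1, hst.2.trans ht.2⟩]

lemma continuous_space (hu : IsRegularSolution α lam κ L T k u₀ u) {t : ℝ} (ht : t ∈ Icc 0 T) :
    Continuous fun x => u x t :=
  (hu.contDiff_space t ht).continuous

lemma continuous_iteratedDeriv (hu : IsRegularSolution α lam κ L T k u₀ u) {t : ℝ}
    (ht : t ∈ Icc 0 T) {i : ℕ} (hi : i ≤ k + 3) :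
    Continuous (iteratedDeriv i fun x => u x t) :=
  (hu.contDiff_space t ht).continuous_iteratedDeriv i (by exact_mod_cast hi)

/-- Time regularity of the moments of the solution on a cell. -/
lemma absCont_integral (hu : IsRegularSolution α lam κ L T k u₀ u) (hT : 0 ≤ T) {a b : ℝ}
    (ha : 0 ≤ a) (hab : a ≤ b) (hb : b ≤ L) {ψ : ℝ → ℝ} (hψ : Continuous ψ) :
    AbsolutelyContinuousOnInterval (fun t => ∫ x in a..b, u x t * ψ x) 0 T := by
  set g : ℝ × ℝ → ℝ := fun z => deriv (fun t => u z.1 t) z.2 with hg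
  have hI : Integrable g ((volume.restrict (Ioc a b)).prod (volume.restrict (Ioc 0 T))) := by
    have h1 := hu.integrable_time_deriv
    unfold IntegrableOn at h1
    rw [Measure.volume_eq_prod, ← Measure.prod_restrict, restrict_Ioo_eq_restrict_Ioc,
      restrict_Ioo_eq_restrict_Ioc, Measure.prod_restrict] at h1
    rw [Measure.prod_restrict]
    exact IntegrableOn.mono_set h1 (prod_mono_left (Ioc_subset_Ioc ha hb))
  obtain ⟨K, hK⟩ := isCompact_Icc.exists_bound_of_continuousOn (s := Icc a b) hψ.continuousOn
  have hIψ : Integrable (fun z => g z * ψ z.1)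
      ((volume.restrict (Ioc a b)).prod (volume.restrict (Ioc 0 T))) := by
    refine hI.mul_bdd (c := K) (hψ.comp continuous_fst).aestronglyMeasurable ?_
    rw [Measure.prod_restrict, ae_restrict_iff' (measurableSet_Ioc.prod measurableSet_Ioc)]
    exact Eventually.of_forall fun z hz => hK _ (Ioc_subset_Icc_self hz.1)
  have hG : IntervalIntegrable (fun s => ∫ x in a..b, g (x, s) * ψ x) volume 0 T := by
    rw [intervalIntegrable_iff_integrableOn_Ioc_of_le hT]
    simp_rw [intervalIntegral.integral_of_le hab]
    exact hIψ.integral_prod_right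
  -- Fubini exhibits the moment as its initial value plus the primitive of an integrable function of
  -- time.
  refine absolutelyContinuousOnInterval_congr
    ((hG.absolutelyContinuousOnInterval_intervalIntegral left_mem_uIcc).fun_add
      (absolutelyContinuousOnInterval_const (∫ x in a..b, u x 0 * ψ x) 0 T)) ?_
  intro t ht
  rw [uIcc_of_le hT] at ht
  simp only
  have hswap := intervalIntegral_intervalIntegral_swap (F := fun x s => g (x, s) * ψ x)
    (a := a) (b := b) (c := 0) (d := t) (by
      rw [uIoc_of_le hab, uIoc_of_le ht.1]
      rw [Measure.prod_restrict] at hIψ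
      exact IntegrableOn.mono_set hIψ (prod_mono_right (Ioc_subset_Ioc_right ht.2)))
  rw [← hswap]
  have hsub : uIcc 0 t ⊆ uIcc 0 T := by
    rw [uIcc_of_le ht.1, uIcc_of_le hT]
    exact Icc_subset_Icc_right ht.2
  have hx : ∀ x, ∫ s in (0 : ℝ)..t, g (x, s) * ψ x = (u x t - u x 0) * ψ x := by
    intro x
    rw [intervalIntegral.integral_mul_const, hg]
    congr 1
    exact ((hu.absCont_time x).mono hsub).integral_deriv_eq_sub
  simp_rw [hx]
  have hc := hu.continuous_space ht
  have hc0 := hu.continuous_space ⟨le_refl 0, hT⟩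
  rw [← intervalIntegral.integral_add (Continuous.intervalIntegrable (by fun_prop) _ _)
    (Continuous.intervalIntegrable (by fun_prop) _ _)]
  refine intervalIntegral.integral_congr fun x _ => ?_
  ring

/-- The moments of the solution satisfy the moments of the equation. -/
lemma ae_abelInt_deriv_integral (hu : IsRegularSolution α lam κ L T k u₀ u) (hα₀ : 0 < α)
    (hα₁ : α < 1) (hT : 0 ≤ T) {a b : ℝ} (ha : 0 ≤ a) (hab : a ≤ b) (hb : b ≤ L) {ψ : ℝ → ℝ}
    (hψ : Continuous ψ) :
    ∀ᵐ t : ℝ, t ∈ Ioc 0 T →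
      abelInt α (deriv fun r => Real.exp (lam * r) * ∫ x in a..b, u x r * ψ x) t
      = Real.Gamma (1 - α) * κ * (Real.exp (lam * t)
          * ∫ x in a..b, iteratedDeriv 2 (fun y => u y t) x * ψ x) := by
  set f : ℝ → ℝ → ℝ := fun x s => Real.Gamma (1 - α) * κ
    * (Real.exp (lam * s) * iteratedDeriv 2 (fun y => u y s) x) with hf
  have hfc : ContinuousOn (fun z : ℝ × ℝ => f z.1 z.2 * ψ z.1) (Icc a b ×ˢ Icc 0 T) := by
    have h2 := (hu.continuousOn_deriv 2 (by omega)).mono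
      (prod_mono_left (subset_univ (Icc a b)))
    have h3 : ContinuousOn (fun z : ℝ × ℝ => Real.exp (lam * z.2)) (Icc a b ×ˢ Icc 0 T) := by
      fun_prop
    exact ((continuousOn_const.mul (h3.mul h2))).mul
      (hψ.comp continuous_fst).continuousOn
  have hcompact : IsCompact (Icc a b ×ˢ Icc 0 T) := isCompact_Icc.prod isCompact_Icc
  obtain ⟨K, hK⟩ := hcompact.exists_bound_of_continuousOn hfc
  have hbound : ∀ {κ' : ℝ → ℝ} {t : ℝ}, t ∈ Icc 0 T → IntervalIntegrable κ' volume 0 t →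
      Integrable (fun z : ℝ × ℝ => κ' z.2 * (f z.1 z.2 * ψ z.1))
        ((volume.restrict (Ioc a b)).prod (volume.restrict (Ioc 0 t))) := by
    intro κ' t ht hκ'
    rw [intervalIntegrable_iff_integrableOn_Ioc_of_le ht.1] at hκ'
    have hsub : Ioc a b ×ˢ Ioc 0 t ⊆ Icc a b ×ˢ Icc 0 T :=
      prod_mono Ioc_subset_Icc_self (Ioc_subset_Icc_self.trans (Icc_subset_Icc_right ht.2))
    refine (hκ'.comp_snd (volume.restrict (Ioc a b))).mul_bdd (c := K) ?_ ?_
    · rw [Measure.prod_restrict]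
      exact (hfc.mono hsub).aestronglyMeasurable (measurableSet_Ioc.prod measurableSet_Ioc)
    · rw [Measure.prod_restrict, ae_restrict_iff' (measurableSet_Ioc.prod measurableSet_Ioc)]
      exact Eventually.of_forall fun z hz => hK _ (hsub hz)
  have hF : ∀ t, ∫ x in a..b, f x t * ψ x = Real.Gamma (1 - α) * κ * (Real.exp (lam * t)
          * ∫ x in a..b, iteratedDeriv 2 (fun y => u y t) x * ψ x) := by
    intro t
    rw [← intervalIntegral.integral_const_mul, ← intervalIntegral.integral_const_mul]
    refine intervalIntegral.integral_congr fun x _ => ?_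
    simp only [hf]
    ring
  simp_rw [← hF]
  have hTm : T ∈ Icc 0 T := ⟨hT, le_refl T⟩
  -- The equation cannot be integrated in `x` directly, as its exceptional times vary with `x`. The
  -- integrated form is averaged instead, and the derivative recovered from uniqueness for Abel's
  -- equation.
  refine abelInt_deriv_eq_of_abelInt_eq hα₀ hα₁ hT
    ((absolutelyContinuousOnInterval_exp lam 0 T).fun_mul
      (hu.absCont_integral hT ha hab hb hψ)) ?_ ?_ ?_
  · have h2 := (hbound hTm (κ' := fun _ => 1) intervalIntegrable_const).integral_prod_right
    rw [intervalIntegrable_iff_integrableOn_Ioc_of_le hT]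
    simp_rw [intervalIntegral.integral_of_le hab]
    simp only [one_mul] at h2
    exact h2
  · intro t ht
    have h2 := (hbound ht (intervalIntegrable_abel_const (t := t) (β := 1 - α)
      (by linarith))).integral_prod_right
    rw [intervalIntegrable_iff_integrableOn_Ioc_of_le ht.1]
    simp_rw [intervalIntegral.integral_of_le hab]
    simp only [integral_const_mul] at h2
    exact h2
  · intro t ht
    have hswap := intervalIntegral_intervalIntegral_swap
      (F := fun x s => (t - s) ^ (-(1 - α)) * (f x s * ψ x)) (a := a) (b := b) (c := 0) (d := t)
      (by
        rw [uIoc_of_le hab, uIoc_of_le ht.1]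
        have h2 := hbound ht (intervalIntegrable_abel_const (t := t) (β := 1 - α) (by linarith))
        rw [Measure.prod_restrict] at h2
        exact h2)
    have h3 : abelInt (1 - α) (fun s => ∫ x in a..b, f x s * ψ x) t
        = ∫ s in (0 : ℝ)..t, ∫ x in a..b, (t - s) ^ (-(1 - α)) * (f x s * ψ x) := by
      unfold abelInt
      refine intervalIntegral.integral_congr fun s _ => ?_
      exact (intervalIntegral.integral_const_mul _ _).symm
    rw [h3, ← hswap]
    have h4 : ∀ x, ∫ s in (0 : ℝ)..t, (t - s) ^ (-(1 - α)) * (f x s * ψ x)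
        = Real.Gamma α * Real.Gamma (1 - α)
        * (Real.exp (lam * t) * u x t - Real.exp (lam * 0) * u x 0) * ψ x := by
      intro x
      rw [hu.abelInt_eq hα₀ hα₁ x ht, abelInt, ← intervalIntegral.integral_mul_const]
      refine intervalIntegral.integral_congr fun s _ => ?_
      simp only [hf]
      ring
    simp_rw [h4]
    have hc := hu.continuous_space ht
    have hc0 := hu.continuous_space ⟨le_refl 0, hT⟩
    rw [← intervalIntegral.integral_const_mul, ← intervalIntegral.integral_const_mul,
      ← intervalIntegral.integral_sub (Continuous.intervalIntegrable (by fun_prop) _ _)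
        (Continuous.intervalIntegrable (by fun_prop) _ _), ← intervalIntegral.integral_const_mul]
    refine intervalIntegral.integral_congr fun x _ => ?_
    ring

end IsRegularSolution

/-! ### The discrete solution in coefficients, and mass matrices -/

/-- The coefficients of a polynomial are linear combinations of its values. -/
lemma exists_coeff_eq_sum_eval (n i : ℕ) : ∃ ω : Fin n → ℝ, ∀ p ∈ degreeLT ℝ n,
    p.coeff i = ∑ m : Fin n, ω m * p.eval (m : ℝ) := by
  refine ⟨fun m => (Lagrange.basis Finset.univ (fun m : Fin n => ((m : ℕ) : ℝ)) m).coeff i,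
    fun p hp => ?_⟩
  have hinj : Set.InjOn (fun m : Fin n => ((m : ℕ) : ℝ)) (Finset.univ : Finset (Fin n)) := by
    intro a _ b _ hab
    exact Fin.ext (Nat.cast_injective (R := ℝ) hab)
  have hdeg : p.degree < (Finset.univ : Finset (Fin n)).card := by
    rw [Finset.card_fin]
    exact mem_degreeLT.1 hp
  conv_lhs => rw [Lagrange.eq_interpolate hinj hdeg]
  rw [Lagrange.interpolate_apply, finsetSum_coeff]
  exact Finset.sum_congr rfl fun m _ => by rw [coeff_C_mul, mul_comm]

namespace Mesh.IsSemiDiscreteSolution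

variable {M : Mesh L} {uh ph : ℝ → M.Space k}

/-- Lagrange interpolation transfers the time regularity assumed for point values to the
coefficients. -/
lemma absCont_coeff (h : IsSemiDiscreteSolution α lam κ T uh ph) (j : Fin M.N) (i : ℕ) :
    AbsolutelyContinuousOnInterval (fun t => (uh t j : ℝ[X]).coeff i) 0 T := by
  obtain ⟨ω, hω⟩ := exists_coeff_eq_sum_eval (k + 1) i
  simp_rw [fun t => hω _ (uh t j).2]
  exact absolutelyContinuousOnInterval_sum _ fun m _ => (h.absCont_time j _).const_mul _

/-- One null set of times serves all points `x`, because only the finitely many coefficients are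
differentiated. In particular the fractional derivative of `u_h` is a polynomial on each cell. -/
lemma ae_caputoTempered_eq (h : IsSemiDiscreteSolution α lam κ T uh ph) (hα₀ : 0 < α)
    (hα₁ : α < 1) (hT : 0 ≤ T) :
    ∀ᵐ t : ℝ, t ∈ Ioc 0 T → ∀ j x,
      Real.Gamma (1 - α) * Real.exp (lam * t) * caputoTempered α lam (fun s => val (uh s) j x) t
      = (polyOf fun i : Fin (k + 1) => abelInt α
          (deriv fun r => Real.exp (lam * r) * (uh r j : ℝ[X]).coeff i) t).eval x := by
  have h2 : ∀ᵐ t : ℝ, ∀ j, t ∈ Ioc 0 T → _ := ae_all_iff.2 fun j => abelInt_deriv_sum hα₀ hα₁ hT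
    (c := fun (i : Fin (k + 1)) r => Real.exp (lam * r) * (uh r j : ℝ[X]).coeff i) fun i =>
      (absolutelyContinuousOnInterval_exp lam 0 T).fun_mul (h.absCont_coeff j i)
  filter_upwards [h2] with t ht htm j x
  rw [← abelInt_deriv_exp_mul hα₁, eval_polyOf]
  have h3 := (ht j htm fun i => x ^ (i : ℕ)).2
  simp_rw [mul_comm _ (x ^ _)]
  rw [← h3]
  congr 2
  funext r
  rw [val, ← polyOf_coeff (uh r j).2, eval_polyOf, Finset.mul_sum]
  refine Finset.sum_congr rfl fun i _ => ?_
  rw [polyOf_coeff (uh r j).2]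
  ring

end Mesh.IsSemiDiscreteSolution

lemma iteratedDeriv_iteratedDeriv (m i : ℕ) (f : ℝ → ℝ) :
    iteratedDeriv m (iteratedDeriv i f) = iteratedDeriv (m + i) f := by
  rw [iteratedDeriv_eq_iterate, iteratedDeriv_eq_iterate, iteratedDeriv_eq_iterate,
    Function.iterate_add_apply]

/-- The mass matrix of a cell. -/
def massMatrix (n : ℕ) (a b : ℝ) (i i' : Fin n) : ℝ :=
  ∫ x in a..b, x ^ (i : ℕ) * x ^ (i' : ℕ)

lemma sum_massMatrix {n : ℕ} (a b : ℝ) (v w : Fin n → ℝ) :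
    ∑ i', (∑ i, massMatrix n a b i i' * v i) * w i'
      = ∫ x in a..b, (polyOf v).eval x * (polyOf w).eval x := by
  have h1 : ∀ x, (polyOf v).eval x * (polyOf w).eval x
      = ∑ i', ∑ i, (v i * w i') * (x ^ (i : ℕ) * x ^ (i' : ℕ)) := by
    intro x
    rw [eval_polyOf, eval_polyOf, Finset.sum_mul_sum, Finset.sum_comm]
    exact Finset.sum_congr rfl fun i _ => Finset.sum_congr rfl fun i' _ => by ring
  simp_rw [h1]
  rw [intervalIntegral.integral_finsetSum fun i' _ =>
    Continuous.intervalIntegrable (by fun_prop) _ _]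
  refine Finset.sum_congr rfl fun i' _ => ?_
  rw [intervalIntegral.integral_finsetSum fun i _ =>
    Continuous.intervalIntegrable (by fun_prop) _ _, Finset.sum_mul]
  refine Finset.sum_congr rfl fun i _ => ?_
  rw [intervalIntegral.integral_const_mul, massMatrix]
  ring

lemma quadForm_massMatrix {n : ℕ} (a b : ℝ) (v : Fin n → ℝ) :
    quadForm (massMatrix n a b) v = ∫ x in a..b, (polyOf v).eval x ^ 2 := by
  simp_rw [pow_two]
  rw [← sum_massMatrix, quadForm, Finset.sum_comm]
  simp_rw [Finset.sum_mul]

lemma massMatrix_symm {n : ℕ} (a b : ℝ) (i i' : Fin n) :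
    massMatrix n a b i i' = massMatrix n a b i' i := by
  simp_rw [massMatrix, mul_comm]

/-! ### Approximation of the solution and growth of the discrete error -/

namespace IsRegularSolution

/-- Space derivatives of orders `k + 1` to `k + 3` are bounded on the compact set `[0,L] × [0,T]`,
which serves `u`, `u_x` and `u_xx` at once and uniformly in time. -/
lemma exists_proj_error (hu : IsRegularSolution α lam κ L T k u₀ u) :
    ∃ K : ℝ, 0 ≤ K ∧ ∀ (M : Mesh L), ∀ t ∈ Icc 0 T, ∀ i ≤ 2, ∀ (j : Fin M.N) (c : ℝ) (q : ℝ[X]),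
      c = M.left j ∨ c = M.right j →
      IsCellProj k (M.left j) (M.right j) c (iteratedDeriv i fun x => u x t) q →
      ∀ x ∈ Icc (M.left j) (M.right j),
        |iteratedDeriv i (fun x => u x t) x - q.eval x| ≤ K * M.h ^ (k + 1) := by
  obtain ⟨K₀, hK₀, h₀⟩ := exists_isCellProj_error k (σ := 0) (Or.inl rfl)
  obtain ⟨K₁, hK₁, h₁⟩ := exists_isCellProj_error k (σ := 1) (Or.inr rfl)
  have hb : ∀ i ≤ k + 3, ∃ m : ℝ, ∀ z ∈ Icc 0 L ×ˢ Icc 0 T,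
      ‖iteratedDeriv i (fun x => u x z.2) z.1‖ ≤ m := fun i hi =>
    (isCompact_Icc.prod isCompact_Icc).exists_bound_of_continuousOn
      ((hu.continuousOn_deriv i hi).mono (prod_mono_left (subset_univ _)))
  choose! m hm using hb
  set B : ℝ := |m (k + 1)| + |m (k + 2)| + |m (k + 3)| with hB
  have hmB : ∀ i ≤ 2, m (k + 1 + i) ≤ B := by
    intro i hi
    have e1 := abs_nonneg (m (k + 1))
    have e2 := abs_nonneg (m (k + 2))
    have e3 := abs_nonneg (m (k + 3))
    have e4 := le_abs_self (m (k + 1 + i))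
    interval_cases i <;> simp only [hB, add_zero, add_assoc, Nat.reduceAdd] at e4 ⊢ <;> linarith
  refine ⟨(K₀ + K₁) * B, by positivity, fun M t ht i hi j c q hc hq x hx => ?_⟩
  have hcd : ContDiff ℝ ((k + 1 : ℕ) : WithTop ℕ∞) (iteratedDeriv i fun x => u x t) := by
    rw [iteratedDeriv_eq_iterate]
    refine ContDiff.iterate_deriv' (k + 1) i ((hu.contDiff_space t ht).of_le ?_)
    exact_mod_cast (by omega : k + 1 + i ≤ k + 3)
  have hbd : ∀ y ∈ Icc (M.left j) (M.right j),
      |iteratedDeriv (k + 1) (iteratedDeriv i fun x => u x t) y| ≤ B := by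
    intro y hy
    rw [iteratedDeriv_iteratedDeriv]
    exact (hm (k + 1 + i) (by omega) (y, t) ⟨M.cell_subset j hy, ht⟩).trans (hmB i hi)
  have hB0 : 0 ≤ B := by positivity
  have hlt := M.left_lt_right j
  have hh := M.h_pos
  have hlen : (M.right j - M.left j) ^ (k + 1) ≤ M.h ^ (k + 1) :=
    pow_le_pow_left₀ (sub_nonneg.2 hlt.le) (M.length_le_h j) _
  have key : ∀ K', 0 ≤ K' → K' ≤ K₀ + K₁ →
      K' * (B * (M.right j - M.left j) ^ (k + 1)) ≤ (K₀ + K₁) * B * M.h ^ (k + 1) := by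
    intro K' hK' hle
    rw [mul_assoc]
    have := pow_nonneg (sub_nonneg.2 hlt.le) (k + 1)
    gcongr
  rcases hc with rfl | rfl
  · exact (h₀ _ _ _ hlt (by ring) _ _ B hB0 hcd hbd hq x hx).trans (key K₀ hK₀ (by linarith))
  · exact (h₁ _ _ _ hlt (by ring) _ _ B hB0 hcd hbd hq x hx).trans (key K₁ hK₁ (by linarith))

lemma hasDerivAt_iteratedDeriv (hu : IsRegularSolution α lam κ L T k u₀ u) {t : ℝ}
    (ht : t ∈ Icc 0 T) {i : ℕ} (hi : i ≤ 2) (x : ℝ) :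
    HasDerivAt (iteratedDeriv i fun x => u x t) (iteratedDeriv (i + 1) (fun x => u x t) x) x := by
  rw [iteratedDeriv_succ]
  exact ((hu.contDiff_space t ht).differentiable_iteratedDeriv i
    (by exact_mod_cast (by omega : i < k + 3)) x).hasDerivAt

lemma iteratedDeriv_periodic (hu : IsRegularSolution α lam κ L T k u₀ u) {t : ℝ}
    (ht : t ∈ Ioc 0 T) (i : ℕ) :
    iteratedDeriv i (fun x => u x t) L = iteratedDeriv i (fun x => u x t) 0 := by
  have h1 : (fun x => u (x + L) t) = fun x => u x t := funext (hu.periodic t ht)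
  have h2 := iteratedDeriv_comp_add_const i (fun x => u x t) L
  rw [h1] at h2
  have h3 := congrFun h2 0
  simp only [zero_add] at h3
  exact h3.symm

/-- Growth of the discrete part of the error. -/
lemma exists_growth (hα₀ : 0 < α) (hα₁ : α < 1) (hlam : 0 ≤ lam) (hκ : 0 < κ) (hL : 0 < L)
    (hT : 0 < T) (hu : IsRegularSolution α lam κ L T k u₀ u) :
    ∃ C : ℝ, 0 ≤ C ∧ ∀ (M : Mesh L) (uh ph : ℝ → M.Space k) (E : ℝ),
      Mesh.IsSemiDiscreteSolution α lam κ T uh ph →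
      (∀ t ∈ Icc 0 T, ∀ i ≤ 2, ∀ (j : Fin M.N) (c : ℝ) (q : ℝ[X]),
        c = M.left j ∨ c = M.right j →
        IsCellProj k (M.left j) (M.right j) c (iteratedDeriv i fun x => u x t) q →
        ∀ x ∈ Icc (M.left j) (M.right j),
          |iteratedDeriv i (fun x => u x t) x - q.eval x| ≤ E) →
      ∃ q : ℝ → Fin M.N → ℝ[X],
        (∀ t ∈ Icc 0 T, ∀ j,
          IsCellProj k (M.left j) (M.right j) (M.right j) (fun x => u x t) (q t j)) ∧
        ∀ t ∈ Icc 0 T,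
          ∑ j, ∫ x in (M.left j)..(M.right j), ((q t j).eval x - Mesh.val (uh t) j x) ^ 2
          ≤ C * ((∑ j, ∫ x in (M.left j)..(M.right j),
              ((q 0 j).eval x - Mesh.val (uh 0) j x) ^ 2) + E ^ 2) := by
  have hG := Real.Gamma_pos_of_pos hα₀
  have hG' := Real.Gamma_pos_of_pos (sub_pos.2 hα₁)
  have hTα : 0 < T ^ α := Real.rpow_pos_of_pos hT α
  -- `P` is the factor left after Abel inversion of the energy estimate. The choice of `δ` makes `P
  -- δ = 1/2`, so half of the maximum of `Y` can be absorbed.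
  set P : ℝ := 2 * κ * (T ^ α / α) / Real.Gamma α with hP
  have hPpos : 0 < P := by positivity
  set δ : ℝ := 1 / (2 * P) with hδ
  have hδpos : 0 < δ := by positivity
  set D : ℝ := Real.exp (lam * T) ^ 2 * (L / 4 + L / (4 * δ)) with hD
  have hDpos : 0 < D := by positivity
  refine ⟨2 + 2 * P * D, by positivity, fun M uh ph E hs hE => ?_⟩
  choose ψ β hψ using fun j => exists_isCellProj k (M.left_lt_right j) (c := M.right j)
    (Or.inr rfl)
  choose ψ' β' hψ' using fun j => exists_isCellProj k (M.left_lt_right j) (c := M.left j)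
    (Or.inl rfl)
  let a : Fin M.N → Fin (k + 1) → ℝ → ℝ := fun j i t =>
    (∫ x in (M.left j)..(M.right j), u x t * (ψ j i).eval x) + β j i * u (M.right j) t
  let q : ℝ → Fin M.N → ℝ[X] := fun t j => polyOf fun i => a j i t
  have hq : ∀ t ∈ Icc 0 T, ∀ j,
      IsCellProj k (M.left j) (M.right j) (M.right j) (fun x => u x t) (q t j) := fun t ht j =>
    hψ j _ (hu.continuous_space ht).continuousOn
  refine ⟨q, hq, ?_⟩
  let sc : Fin M.N → Fin (k + 1) → ℝ → ℝ := fun j i t =>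
    (∫ x in (M.left j)..(M.right j), iteratedDeriv 2 (fun y => u y t) x * (ψ j i).eval x)
      + β j i * iteratedDeriv 2 (fun y => u y t) (M.right j)
  let s : ℝ → Fin M.N → ℝ[X] := fun t j => polyOf fun i => sc j i t
  have hsp : ∀ t ∈ Icc 0 T, ∀ j, IsCellProj k (M.left j) (M.right j) (M.right j)
      (iteratedDeriv 2 fun x => u x t) (s t j) := fun t ht j =>
    hψ j _ (hu.continuous_iteratedDeriv ht (by omega)).continuousOn
  let r : ℝ → Fin M.N → ℝ[X] := fun t j => polyOf fun i =>
    (∫ x in (M.left j)..(M.right j), iteratedDeriv 1 (fun y => u y t) x * (ψ' j i).eval x)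
      + β' j i * iteratedDeriv 1 (fun y => u y t) (M.left j)
  have hrp : ∀ t ∈ Icc 0 T, ∀ j, IsCellProj k (M.left j) (M.right j) (M.left j)
      (iteratedDeriv 1 fun x => u x t) (r t j) := fun t ht j =>
    hψ' j _ (hu.continuous_iteratedDeriv ht (by omega)).continuousOn
  let c : Fin M.N → Fin (k + 1) → ℝ → ℝ := fun j i t =>
    Real.exp (lam * t) * (a j i t - (uh t j : ℝ[X]).coeff i)
  let b : Fin M.N → Fin (k + 1) → ℝ → ℝ := fun j i t =>
    abelInt α (deriv fun r => Real.exp (lam * r) * (uh r j : ℝ[X]).coeff i) t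
  have hcell : ∀ j, 0 ≤ M.left j ∧ M.right j ≤ L := fun j => ⟨(M.left_mem j).1, (M.right_mem j).2⟩
  have hexp := absolutelyContinuousOnInterval_exp lam 0 T
  -- Each coefficient of the weighted error combines a moment of `u`, a nodal value of `u` and a
  -- coefficient of `u_h`, whose fractional derivatives are known separately.
  let f : Fin M.N → Fin (k + 1) → Fin 3 → ℝ → ℝ := fun j i =>
    ![fun t => Real.exp (lam * t) * ∫ x in (M.left j)..(M.right j), u x t * (ψ j i).eval x,
      fun t => Real.exp (lam * t) * u (M.right j) t,
      fun t => Real.exp (lam * t) * (uh t j : ℝ[X]).coeff i]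
  have hfac : ∀ j i l, AbsolutelyContinuousOnInterval (f j i l) 0 T := by
    intro j i l
    fin_cases l
    · exact hexp.fun_mul (hu.absCont_integral hT.le (hcell j).1 (M.left_lt_right j).le (hcell j).2
        (ψ j i).continuous)
    · exact hu.absCont_exp_mul _
    · exact hexp.fun_mul (hs.absCont_coeff j i)
  have hcf : ∀ j i, c j i = fun t => ∑ l, (![1, β j i, -1] : Fin 3 → ℝ) l * f j i l t := by
    intro j i
    funext t
    simp only [c, a, f, Fin.sum_univ_three, Matrix.cons_val_zero, Matrix.cons_val_one,
      Matrix.cons_val]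
    ring
  have hcac : ∀ j i, AbsolutelyContinuousOnInterval (c j i) 0 T := by
    intro j i
    rw [hcf]
    exact absolutelyContinuousOnInterval_sum _ fun l _ => (hfac j i l).const_mul _
  have hd : ∀ᵐ t : ℝ, t ∈ Ioc 0 T → ∀ j i, abelInt α (deriv (c j i)) t
      = Real.Gamma (1 - α) * κ * Real.exp (lam * t) * sc j i t - b j i t := by
    have e1 : ∀ᵐ t : ℝ, ∀ j i, t ∈ Ioc 0 T → _ := ae_all_iff.2 fun j => ae_all_iff.2 fun i =>
      abelInt_deriv_sum hα₀ hα₁ hT.le (hfac j i)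
    have e2 : ∀ᵐ t : ℝ, ∀ j i, t ∈ Ioc 0 T → _ := ae_all_iff.2 fun j => ae_all_iff.2 fun i =>
      hu.ae_abelInt_deriv_integral hα₀ hα₁ hT.le (hcell j).1 (M.left_lt_right j).le (hcell j).2
        (ψ j i).continuous
    have e3 : ∀ᵐ t : ℝ, ∀ j, t ∈ Ioc 0 T → _ := ae_all_iff.2 fun j =>
      hu.ae_abelInt_deriv hα₁ (M.right j)
    filter_upwards [e1, e2, e3] with t h1 h2 h3 ht j i
    rw [hcf, (h1 j i ht _).2, Fin.sum_univ_three]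
    simp only [f, Matrix.cons_val_zero, Matrix.cons_val_one, Matrix.cons_val]
    rw [h2 j i ht, h3 j ht]
    simp only [sc, b]
    ring
  let Y : ℝ → ℝ := fun t => ∑ j, quadForm (massMatrix (k + 1) (M.left j) (M.right j))
    fun i => c j i t
  have hpolyc : ∀ t j x, (polyOf fun i => c j i t).eval x
      = Real.exp (lam * t) * ((q t j).eval x - Mesh.val (uh t) j x) := by
    intro t j x
    rw [Mesh.val, ← polyOf_coeff (uh t j).2]
    simp only [q, eval_polyOf, c]
    rw [← Finset.sum_sub_distrib, Finset.mul_sum]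
    exact Finset.sum_congr rfl fun i _ => by ring
  have hY : ∀ t, Y t = Real.exp (lam * t) ^ 2 * ∑ j, ∫ x in (M.left j)..(M.right j),
      ((q t j).eval x - Mesh.val (uh t) j x) ^ 2 := by
    intro t
    rw [Finset.mul_sum]
    refine Finset.sum_congr rfl fun j _ => ?_
    rw [quadForm_massMatrix, ← intervalIntegral.integral_const_mul]
    simp_rw [hpolyc, mul_pow]
  have hqac : ∀ j, AbsolutelyContinuousOnInterval
      (fun t => quadForm (massMatrix (k + 1) (M.left j) (M.right j)) fun i => c j i t) 0 T :=
    fun j => absolutelyContinuousOnInterval_quadForm _ (hcac j)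
  have hYac : AbsolutelyContinuousOnInterval Y 0 T :=
    absolutelyContinuousOnInterval_sum _ fun j _ => hqac j
  -- Bounding `Y(t)` by its maximum makes the right-hand side of the fractional inequality constant
  -- in time.
  obtain ⟨t₁, ht₁, hmax⟩ := isCompact_Icc.exists_isMaxOn (nonempty_Icc.2 hT.le)
    (by simpa [uIcc_of_le hT.le] using hYac.continuousOn)
  have hnn : ∀ t, 0 ≤ ∑ j, ∫ x in (M.left j)..(M.right j),
      ((q t j).eval x - Mesh.val (uh t) j x) ^ 2 := fun t =>
    Finset.sum_nonneg fun j _ => intervalIntegral.integral_nonneg (M.left_lt_right j).le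
      fun x _ => sq_nonneg _
  have hY0 : ∀ t, 0 ≤ Y t := fun t => by
    rw [hY]
    exact mul_nonneg (sq_nonneg _) (hnn t)
  have hle : ∀ᵐ t : ℝ, t ∈ Ioc 0 T →
      abelInt α (deriv Y) t ≤ 2 * (Real.Gamma (1 - α) * κ * (D * E ^ 2 + δ * Y t₁)) := by
    have e1 := abelInt_deriv_sum hα₀ hα₁ hT.le hqac
    have e2 : ∀ᵐ t : ℝ, ∀ j, t ∈ Ioc 0 T → _ := ae_all_iff.2 fun j =>
      abelInt_deriv_quadForm_le hα₀ hα₁ hT.le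
        (massMatrix_symm (n := k + 1) (M.left j) (M.right j)) (fun v => by
          rw [quadForm_massMatrix]
          exact intervalIntegral.integral_nonneg (M.left_lt_right j).le fun x _ => sq_nonneg _)
        (hcac j)
    filter_upwards [e1, e2, hd, hs.ae_caputoTempered_eq hα₀ hα₁ hT.le, hs.equations]
      with t h1 h2 h3 h4 h5 ht
    have htI : t ∈ Icc 0 T := ⟨ht.1.le, ht.2⟩
    have hexp0 := Real.exp_pos (lam * t)
    set Q : Fin M.N → ℝ → ℝ := fun j x => caputoTempered α lam (fun s => Mesh.val (uh s) j x) t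
      with hQ
    have hQe : ∀ j x, Q j x = (Real.Gamma (1 - α) * Real.exp (lam * t))⁻¹
        * (polyOf fun i => b j i t).eval x := by
      intro j x
      rw [← h4 ht j x, inv_mul_cancel_left₀ (mul_pos hG' hexp0).ne']
    have hQc : ∀ j, Continuous (Q j) := fun j => by
      rw [funext (hQe j)]
      fun_prop
    have h6 := h1 ht fun _ => 1
    simp only [one_mul] at h6
    have h7 : abelInt α (deriv Y) t = _ := h6.2
    have hest := energy_estimate hκ hδpos (w := fun x => u x t)
      (w₁ := iteratedDeriv 1 fun x => u x t) (w₂ := iteratedDeriv 2 fun x => u x t)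
      (fun x => by
        have := hu.hasDerivAt_iteratedDeriv htI (i := 0) (by omega) x
        rwa [iteratedDeriv_zero] at this)
      (fun x => hu.hasDerivAt_iteratedDeriv htI (i := 1) (by omega) x)
      (hu.continuous_iteratedDeriv htI (by omega))
      (by
        have := hu.iteratedDeriv_periodic ht 0
        rwa [iteratedDeriv_zero] at this)
      (hu.iteratedDeriv_periodic ht 1) (uh t) (ph t) hQc (hq t htI) (hrp t htI)
      (fun v j => (h5 ht v v j).1) (fun v j => (h5 ht v v j).2) (s := s t) (E₁ := E) (E₂ := E)
      (fun j => hE t htI 1 (by omega) j _ _ (Or.inl rfl) (hrp t htI j))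
      (fun j => hE t htI 2 le_rfl j _ _ (Or.inr rfl) (hsp t htI j))
    -- One factor `e^{lam t}` comes from the weighted error and one from its fractional derivative.
    have hsum : ∑ j, ∑ i', (∑ i, massMatrix (k + 1) (M.left j) (M.right j) i i' * c j i t)
          * abelInt α (deriv (c j i')) t
        = Real.Gamma (1 - α) * Real.exp (lam * t) ^ 2 * ∑ j, ∫ x in (M.left j)..(M.right j),
          (κ * (s t j).eval x - Q j x) * ((q t j).eval x - Mesh.val (uh t) j x) := by
      rw [Finset.mul_sum]
      refine Finset.sum_congr rfl fun j _ => ?_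
      rw [sum_massMatrix, ← intervalIntegral.integral_const_mul]
      refine intervalIntegral.integral_congr fun x _ => ?_
      have h8 : (polyOf fun i => abelInt α (deriv (c j i)) t).eval x
          = Real.Gamma (1 - α) * Real.exp (lam * t) * (κ * (s t j).eval x - Q j x) := by
        have h9 := h4 ht j x
        simp only [h3 ht, eval_polyOf, sub_mul, Finset.sum_sub_distrib, s, hQ] at h9 ⊢
        rw [mul_sub, h9, Finset.mul_sum, Finset.mul_sum]
        congr 1
        exact Finset.sum_congr rfl fun i _ => by ring
      rw [h8, hpolyc]
      ring
    have hexpT : Real.exp (lam * t) ^ 2 ≤ Real.exp (lam * T) ^ 2 :=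
      pow_le_pow_left₀ hexp0.le (Real.exp_le_exp.2 (mul_le_mul_of_nonneg_left ht.2 hlam)) 2
    calc abelInt α (deriv Y) t
        ≤ ∑ j, 2 * ∑ i', (∑ i, massMatrix (k + 1) (M.left j) (M.right j) i i' * c j i t)
          * abelInt α (deriv (c j i')) t := by
          rw [h7]
          exact Finset.sum_le_sum fun j _ => h2 j ht
      _ = 2 * (Real.Gamma (1 - α) * Real.exp (lam * t) ^ 2
          * ∑ j, ∫ x in (M.left j)..(M.right j),
            (κ * (s t j).eval x - Q j x) * ((q t j).eval x - Mesh.val (uh t) j x)) := by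
          rw [← Finset.mul_sum, hsum]
      _ ≤ 2 * (Real.Gamma (1 - α) * Real.exp (lam * t) ^ 2
          * (κ * (L * E ^ 2 / 4 + L * E ^ 2 / (4 * δ) + δ * ∑ j, ∫ x in (M.left j)..(M.right j),
              ((q t j).eval x - Mesh.val (uh t) j x) ^ 2))) := by gcongr
      _ = 2 * (Real.Gamma (1 - α) * κ * (Real.exp (lam * t) ^ 2 * (L / 4 + L / (4 * δ)) * E ^ 2
          + δ * Y t)) := by
          rw [hY]
          ring
      _ ≤ 2 * (Real.Gamma (1 - α) * κ * (D * E ^ 2 + δ * Y t₁)) := by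
          have := isMaxOn_iff.1 hmax t htI
          rw [hD]
          gcongr
  have hfin := sub_le_of_abelInt_deriv_le hα₀ hα₁
    (by have := hY0 t₁; positivity) hYac hle ht₁
  -- Absorption at the maximum gives `Y(t₁) ≤ 2 Y(0) + 2 P D E²`.
  have hm : Y t₁ ≤ (2 + 2 * P * D) * (Y 0 + E ^ 2) := by
    have e1 : Y t₁ - Y 0 ≤ P * (D * E ^ 2 + δ * Y t₁) := by
      have e2 : 2 * (Real.Gamma (1 - α) * κ * (D * E ^ 2 + δ * Y t₁)) * (T ^ α / α)
          = Real.Gamma α * Real.Gamma (1 - α) * (P * (D * E ^ 2 + δ * Y t₁)) := by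
        rw [hP]
        field_simp
      rw [e2] at hfin
      exact le_of_mul_le_mul_left hfin (mul_pos hG hG')
    have e3 : P * (δ * Y t₁) = Y t₁ / 2 := by
      rw [hδ]
      field_simp
    have e4 : 0 ≤ P * D * Y 0 := mul_nonneg (by positivity) (hY0 0)
    nlinarith [sq_nonneg E]
  intro t ht
  have e1 : 1 ≤ Real.exp (lam * t) ^ 2 :=
    one_le_pow₀ (Real.one_le_exp (mul_nonneg hlam ht.1))
  have e2 := isMaxOn_iff.1 hmax t ht
  have e3 : Y 0 = ∑ j, ∫ x in (M.left j)..(M.right j),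
      ((q 0 j).eval x - Mesh.val (uh 0) j x) ^ 2 := by
    rw [hY, mul_zero, Real.exp_zero, one_pow, one_mul]
  rw [← e3]
  refine le_trans ?_ (e2.trans hm)
  rw [hY]
  exact le_mul_of_one_le_left (hnn t) e1

end IsRegularSolution

/-! ### Norms and the final estimate -/

lemma Mesh.errNorm_sq {M : Mesh L} (w : ℝ → ℝ) (v : M.Space k) :
    M.errNorm w v ^ 2
      = ∑ j : Fin M.N, ∫ x in (M.left j)..(M.right j), (w x - Mesh.val v j x) ^ 2 :=
  Real.sq_sqrt (Finset.sum_nonneg fun j _ =>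
    intervalIntegral.integral_nonneg (M.left_lt_right j).le fun _ _ => sq_nonneg _)

lemma Mesh.errNorm_nonneg {M : Mesh L} (w : ℝ → ℝ) (v : M.Space k) : 0 ≤ M.errNorm w v :=
  Real.sqrt_nonneg _

lemma Mesh.errNorm_congr {M : Mesh L} {w w' : ℝ → ℝ} (h : EqOn w w' (Icc 0 L)) (v : M.Space k) :
    M.errNorm w v = M.errNorm w' v := by
  unfold Mesh.errNorm
  congr 1
  refine Finset.sum_congr rfl fun j _ => intervalIntegral.integral_congr fun x hx => ?_
  rw [uIcc_of_le (M.left_lt_right j).le] at hx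
  simp only [h (M.cell_subset j hx)]

lemma sum_integral_sq_le_two_mul {M : Mesh L} {f g p : Fin M.N → ℝ → ℝ}
    (hf : ∀ j, Continuous (f j)) (hg : ∀ j, Continuous (g j)) (hp : ∀ j, Continuous (p j)) :
    ∑ j, ∫ x in (M.left j)..(M.right j), (f j x - g j x) ^ 2
      ≤ 2 * (∑ j, ∫ x in (M.left j)..(M.right j), (f j x - p j x) ^ 2)
        + 2 * ∑ j, ∫ x in (M.left j)..(M.right j), (p j x - g j x) ^ 2 := by
  rw [Finset.mul_sum, Finset.mul_sum, ← Finset.sum_add_distrib]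
  refine Finset.sum_le_sum fun j _ => ?_
  have h1 := hf j
  have h2 := hg j
  have h3 := hp j
  rw [← intervalIntegral.integral_const_mul, ← intervalIntegral.integral_const_mul,
    ← intervalIntegral.integral_add (Continuous.intervalIntegrable (by fun_prop) _ _)
      (Continuous.intervalIntegrable (by fun_prop) _ _)]
  refine intervalIntegral.integral_mono_on (M.left_lt_right j).le
    (Continuous.intervalIntegrable (by fun_prop) _ _)
    (Continuous.intervalIntegrable (by fun_prop) _ _) fun x _ => ?_
  nlinarith [sq_nonneg (f j x - p j x - (p j x - g j x))]

lemma Mesh.IsProjMinus.isCellProj {M : Mesh L} {w w' : ℝ → ℝ} {v : M.Space k}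
    (hv : Mesh.IsProjMinus w v) (h : EqOn w' w (Icc 0 L)) (j : Fin M.N) :
    IsCellProj k (M.left j) (M.right j) (M.right j) w' (v j : ℝ[X]) := by
  refine ⟨(v j).2, fun p hp => ?_, ?_⟩
  · rw [← (hv j).1 p hp]
    refine intervalIntegral.integral_congr fun x hx => ?_
    rw [uIcc_of_le (M.left_lt_right j).le] at hx
    simp only [h (M.cell_subset j hx), Mesh.val]
  · rw [h (M.right_mem j)]
    exact (hv j).2

end TemperedLDG

end

theorem mainTheorem3 (α lam κ L T : ℝ) (hα₀ : 0 < α) (hα₁ : α < 1) (hlam : 0 ≤ lam) (hκ : 0 < κ)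
    (hL : 0 < L) (hT : 0 < T) (k : ℕ) (u₀ : ℝ → ℝ) (u : ℝ → ℝ → ℝ)
    (hu : TemperedLDG.IsRegularSolution α lam κ L T k u₀ u) :
    ∃ C : ℝ, 0 < C ∧
      ∀ (M : TemperedLDG.Mesh L) (uh ph : ℝ → M.Space k),
        TemperedLDG.Mesh.IsSemiDiscreteSolution α lam κ T uh ph →
        (∀ t ∈ Set.Icc 0 T,
          TemperedLDG.Mesh.errNorm (fun x => u x t) (uh t) ≤
            C * (M.h ^ (k + 1) + TemperedLDG.Mesh.errNorm u₀ (uh 0))) ∧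
        (TemperedLDG.Mesh.IsProjMinus u₀ (uh 0) →
          ∀ t ∈ Set.Icc 0 T,
            TemperedLDG.Mesh.errNorm (fun x => u x t) (uh t) ≤ C * M.h ^ (k + 1)) := by
  open TemperedLDG in
  obtain ⟨K, hK, hproj⟩ := hu.exists_proj_error
  obtain ⟨G, hG, hgrowth⟩ := hu.exists_growth hα₀ hα₁ hlam hκ hL hT
  -- The triangle inequality in squared form is used at time `t` and at time `0`. It leaves the
  -- factor `2L + 2G(1 + 2L)` on the squared projection error bound and `4G` on the squared initial
  -- error; `A` dominates both.
  set A : ℝ := 2 * L + 2 * G * (1 + 2 * L) + 4 * G with hA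
  have hA0 : 0 ≤ A := by positivity
  set C₀ : ℝ := Real.sqrt A * (K + 1) + 1 with hC₀
  have hC₀pos : 0 < C₀ := by positivity
  set S : ℝ := Real.sqrt L * K with hS
  have hS0 : 0 ≤ S := by positivity
  have h0T : (0 : ℝ) ∈ Set.Icc 0 T := ⟨le_rfl, hT.le⟩
  have hinit : Set.EqOn (fun x => u x 0) u₀ (Set.Icc 0 L) := hu.initial
  have main : ∀ (M : Mesh L) (uh ph : ℝ → M.Space k),
      Mesh.IsSemiDiscreteSolution α lam κ T uh ph → ∀ t ∈ Set.Icc 0 T,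
        Mesh.errNorm (fun x => u x t) (uh t) ≤
          C₀ * (M.h ^ (k + 1) + Mesh.errNorm u₀ (uh 0)) := by
    intro M uh ph hs t ht
    obtain ⟨q, hq, hle⟩ := hgrowth M uh ph (K * M.h ^ (k + 1)) hs (hproj M)
    set H : ℝ := M.h ^ (k + 1) with hH
    have hH0 : 0 < H := pow_pos M.h_pos _
    set e := Mesh.errNorm u₀ (uh 0) with he
    have he0 : 0 ≤ e := Mesh.errNorm_nonneg _ _
    have hη : ∀ t ∈ Set.Icc 0 T, ∑ j, ∫ x in (M.left j)..(M.right j),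
        (u x t - (q t j).eval x) ^ 2 ≤ L * (K * H) ^ 2 := fun t ht =>
      Mesh.sum_integral_sq_le fun j x hx => by
        have := hproj M t ht 0 (by omega) j _ (q t j) (Or.inr rfl)
          (by rw [iteratedDeriv_zero]; exact hq t ht j) x hx
        rwa [iteratedDeriv_zero] at this
    have e1 := sum_integral_sq_le_two_mul (M := M) (f := fun _ x => u x t)
      (g := fun j => Mesh.val (uh t) j) (p := fun j x => (q t j).eval x)
      (fun _ => hu.continuous_space ht) (fun j => Mesh.continuous_val _ j)
      (fun j => (q t j).continuous)
    have e2 := sum_integral_sq_le_two_mul (M := M) (f := fun j x => (q 0 j).eval x)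
      (g := fun j => Mesh.val (uh 0) j) (p := fun _ x => u x 0)
      (fun j => (q 0 j).continuous) (fun j => Mesh.continuous_val _ j)
      (fun _ => hu.continuous_space h0T)
    have e3 : ∑ j, ∫ x in (M.left j)..(M.right j), ((q 0 j).eval x - u x 0) ^ 2
        ≤ L * (K * H) ^ 2 := by
      refine le_of_eq_of_le ?_ (hη 0 h0T)
      refine Finset.sum_congr rfl fun j _ => intervalIntegral.integral_congr fun x _ => ?_
      exact sub_sq_comm _ _
    have e4 : ∑ j, ∫ x in (M.left j)..(M.right j), (u x 0 - Mesh.val (uh 0) j x) ^ 2 = e ^ 2 := by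
      rw [← Mesh.errNorm_sq (fun x => u x 0), Mesh.errNorm_congr hinit]
    rw [e4] at e2
    rw [← Mesh.errNorm_sq (fun x => u x t)] at e1
    have e5 := hle t ht
    have e6 := hη t ht
    have e7 : Mesh.errNorm (fun x => u x t) (uh t) ^ 2 ≤ A * ((K * H) ^ 2 + e ^ 2) := by
      have e8 := e2.trans (add_le_add_left (mul_le_mul_of_nonneg_left e3 zero_le_two) _)
      have e9 := mul_le_mul_of_nonneg_left (add_le_add_left e8 ((K * H) ^ 2)) hG
      have e10 : A * ((K * H) ^ 2 + e ^ 2) = 2 * (L * (K * H) ^ 2)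
          + 2 * (G * ((2 * (L * (K * H) ^ 2) + 2 * e ^ 2) + (K * H) ^ 2))
          + (2 * L + 2 * G * (1 + 2 * L)) * e ^ 2 + 4 * G * (K * H) ^ 2 := by
        rw [hA]
        ring
      have e11 : 0 ≤ (2 * L + 2 * G * (1 + 2 * L)) * e ^ 2 + 4 * G * (K * H) ^ 2 := by positivity
      rw [e10]
      linarith
    have e8 : A * ((K * H) ^ 2 + e ^ 2) ≤ (C₀ * (H + e)) ^ 2 := by
      have f1 : A = Real.sqrt A ^ 2 := (Real.sq_sqrt hA0).symm
      have f2 : (K * H) ^ 2 + e ^ 2 ≤ ((K + 1) * (H + e)) ^ 2 := by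
        have g1 : 0 ≤ K * H := by positivity
        have g2 : K * H + e ≤ (K + 1) * (H + e) := by nlinarith [mul_nonneg hK he0]
        calc (K * H) ^ 2 + e ^ 2 ≤ (K * H + e) ^ 2 := by nlinarith
          _ ≤ _ := pow_le_pow_left₀ (by positivity) g2 2
      calc A * ((K * H) ^ 2 + e ^ 2) ≤ Real.sqrt A ^ 2 * ((K + 1) * (H + e)) ^ 2 := by
            rw [← f1]
            gcongr
        _ = (Real.sqrt A * (K + 1) * (H + e)) ^ 2 := by ring
        _ ≤ _ := by
            refine pow_le_pow_left₀ (by positivity) ?_ 2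
            gcongr
            rw [hC₀]
            linarith
    exact le_of_sq_le_sq (e7.trans e8) (by positivity)
  -- With the projected initial value, the initial error is itself a projection error, at most `S
  -- h^{k+1}`. The factor `1 + S` covers this case and the general one.
  refine ⟨C₀ * (1 + S), by positivity, fun M uh ph hs => ⟨fun t ht => ?_, fun hpm t ht => ?_⟩⟩
  · refine (main M uh ph hs t ht).trans ?_
    have h1 := pow_pos M.h_pos (k + 1)
    have h2 : 0 ≤ Mesh.errNorm u₀ (uh 0) := Mesh.errNorm_nonneg _ _
    refine mul_le_mul_of_nonneg_right ?_ (by positivity)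
    exact le_mul_of_one_le_right hC₀pos.le (by linarith)
  · have h1 := pow_pos M.h_pos (k + 1)
    have h2 : Mesh.errNorm u₀ (uh 0) ≤ S * M.h ^ (k + 1) := by
      have h3 : Mesh.errNorm u₀ (uh 0) ^ 2 ≤ (S * M.h ^ (k + 1)) ^ 2 := by
        rw [← Mesh.errNorm_congr hinit, Mesh.errNorm_sq]
        have h4 : L = Real.sqrt L ^ 2 := (Real.sq_sqrt hL.le).symm
        calc _ ≤ L * (K * M.h ^ (k + 1)) ^ 2 := Mesh.sum_integral_sq_le fun j x hx => by
              have := hproj M 0 h0T 0 (by omega) j _ (uh 0 j) (Or.inr rfl)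
                (by rw [iteratedDeriv_zero]; exact hpm.isCellProj hinit j) x hx
              rwa [iteratedDeriv_zero] at this
          _ = _ := by
              rw [hS]
              nth_rewrite 1 [h4]
              ring
      exact le_of_sq_le_sq h3 (by positivity)
    refine (main M uh ph hs t ht).trans ?_
    rw [mul_assoc]
    refine mul_le_mul_of_nonneg_left ?_ hC₀pos.le
    linarith
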